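/- Conventions. Let $M$ be a von Neumann algebra on a complex Hilbert space $\mathcal H$, with commutant $M'$. A vector $\Psi\in\mathcal H$ is cyclic for $M$ if $\{O\Psi : O\in M\}$ is dense in $\mathcal H$, and separating for $M$ if $O\in M$, $O\Psi=0$ imply $O=0$. For $\Psi$ cyclic and separating for $M$ and any $\Phi\in\mathcal H$, the relative Tomita operator $S_{\Psi|\Phi}$ is the closed, densely defined, conjugate-linear operator with $S_{\Psi|\Phi}x=y$ whenever there is a sequence $O_n\in M$ with $O_n\Psi\to x$ and $O_n^\dagger\Phi\to y$; the relative modular operator is $\Delta_{\Psi|\Phi}=S_{\Psi|\Phi}^\dagger S_{\Psi|\Phi}$, a positive self-adjoint operator. The relative entropy is $$\mathcal S_{\Psi|\Phi}(M)=-\langle\Psi|\log\Delta_{\Psi|\Phi}|\Psi\rangle=-\int_{[0,\infty)}\log\lambda\; d\langle\Psi|P_\lambda|\Psi\rangle\in[-\infty,+\infty],$$ where $P$ is the unique projection valued measure on $\mathbb R$ with $\Delta_{\Psi|\Phi}=\int\lambda\,dP_\lambda$ and $\log 0=-\infty$. Theorem. Let $u:\mathcal H_{code}\to\mathcal H_{phys}$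 be a linear isometry between two complex Hilbert spaces, and let $M_{code}$ and $M_{phys}$ be von Neumann algebras on $\mathcal H_{code}$ and $\mathcal H_{phys}$, with commutants $M_{code}'$ and $M_{phys}'$. Suppose that * there exists $\Omega\in\mathcal H_{code}$ such that $u\Omega$ is cyclic and separating for $M_{phys}$; * for all $O\in M_{code}$ and $O'\in M_{code}'$ there exist $\tilde O\in M_{phys}$ and $\tilde O'\in M_{phys}'$ such that for all $\Theta\in\mathcal H_{code}$ $$uO\Theta=\tilde O u\Theta,\quad uO'\Theta=\tilde O'u\Theta,\quad uO^\dagger\Theta=\tilde O^\dagger u\Theta,\quad uO'^\dagger\Theta=\tilde O'^\dagger u\Theta .$$ Then for all $\Psi,\Phi\in\mathcal H_{code}$ with $\Psi$ cyclic and separating for $M_{code}$: * $u\Psi$ is cyclic and separating for $M_{phys}$ and for $M_{phys}'$; * the relative entropies below are well defined, and $$\mathcal S_{\Psi|\Phi}(M_{code})=\mathcal S_{u\Psi|u\Phi}(M_{phys}),\qquad \mathcal S_{\Psi|\Phi}(M_{code}')=\mathcal S_{u\Psi|u\Phi}(M_{phys}').$$ -/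

import Mathlib

open scoped ENNReal InnerProductSpace

/-! ### Cyclic and separating vectors -/

section Vectors

variable {H : Type*} [NormedAddCommGroup H] [InnerProductSpace ℂ H] [CompleteSpace H]

/-- `Ψ` is cyclic for `M`: the vectors `O Ψ` with `O ∈ M` are dense. -/
def IsCyclicVector (M : VonNeumannAlgebra H) (Ψ : H) : Prop :=
  Dense {x : H | ∃ O ∈ M, O Ψ = x}

/-- `Ψ` is separating for `M`: zero is the only element of `M` that annihilates `Ψ`. -/
def IsSeparatingVector (M : VonNeumannAlgebra H) (Ψ : H) : Prop :=
  ∀ O ∈ M, O Ψ = 0 → O = 0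

/-! ### The relative Tomita operator and the relative modular operator -/

/-- The graph of the relative Tomita operator `S_{Ψ|Φ}`: the pairs `(x, y)` for which some sequence
`O n` in `M` satisfies `O n Ψ → x` and `(O n)† Φ → y`. For `Ψ` cyclic and separating this is the
graph of a closed densely defined conjugate-linear operator. -/
def relativeTomitaGraph (M : VonNeumannAlgebra H) (Ψ Φ : H) : Set (H × H) :=
  {p | ∃ O : ℕ → (H →L[ℂ] H), (∀ n, O n ∈ M) ∧
    Filter.Tendsto (fun n => O n Ψ) Filter.atTop (nhds p.1) ∧
    Filter.Tendsto (fun n => (star (O n)) Φ) Filter.atTop (nhds p.2)}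

/-- The graph of the adjoint of a conjugate-linear operator with graph `S`: the pairs `(φ, η)` with
`⟪φ, S x⟫ = conj ⟪η, x⟫` for all `x` in the domain of `S`. -/
def conjAdjointGraph (S : Set (H × H)) : Set (H × H) :=
  {q | ∀ p ∈ S, ⟪q.1, p.2⟫_ℂ = (starRingEnd ℂ) ⟪q.2, p.1⟫_ℂ}

theorem relativeTomitaGraph_zero (M : VonNeumannAlgebra H) (Ψ Φ : H) :
    ((0 : H), (0 : H)) ∈ relativeTomitaGraph M Ψ Φ :=
  ⟨fun _ => 0, fun _ => zero_mem M, by simp, by simp⟩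

theorem relativeTomitaGraph_add {M : VonNeumannAlgebra H} {Ψ Φ x y x' y' : H}
    (h : (x, y) ∈ relativeTomitaGraph M Ψ Φ) (h' : (x', y') ∈ relativeTomitaGraph M Ψ Φ) :
    (x + x', y + y') ∈ relativeTomitaGraph M Ψ Φ := by
  obtain ⟨O, hO, h1, h2⟩ := h
  obtain ⟨O', hO', h1', h2'⟩ := h'
  exact ⟨fun n => O n + O' n, fun n => add_mem (hO n) (hO' n),
    by simpa using h1.add h1', by simpa using h2.add h2'⟩

theorem relativeTomitaGraph_smul {M : VonNeumannAlgebra H} {Ψ Φ x y : H} (c : ℂ)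
    (h : (x, y) ∈ relativeTomitaGraph M Ψ Φ) :
    (c • x, (starRingEnd ℂ) c • y) ∈ relativeTomitaGraph M Ψ Φ := by
  obtain ⟨O, hO, h1, h2⟩ := h
  refine ⟨fun n => c • O n, fun n => M.toStarSubalgebra.smul_mem (hO n) c,
    by simpa using h1.const_smul c, ?_⟩
  simpa [star_smul] using h2.const_smul ((starRingEnd ℂ) c)

/-- The graph of `S_{Ψ|Φ}† S_{Ψ|Φ}`: the pairs `(x, z)` such that `x` is in the domain of
`S_{Ψ|Φ}`, `S_{Ψ|Φ} x` is in the domain of the adjoint, and the adjoint maps it to `z`. -/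
def relativeModularGraph (M : VonNeumannAlgebra H) (Ψ Φ : H) : Submodule ℂ (H × H) where
  carrier := {p | ∃ y : H, (p.1, y) ∈ relativeTomitaGraph M Ψ Φ ∧
    (y, p.2) ∈ conjAdjointGraph (relativeTomitaGraph M Ψ Φ)}
  zero_mem' := ⟨0, relativeTomitaGraph_zero M Ψ Φ, fun p _ => by simp⟩
  add_mem' := by
    rintro p p' ⟨y, hy, hz⟩ ⟨y', hy', hz'⟩
    refine ⟨y + y', relativeTomitaGraph_add hy hy', fun q hq => ?_⟩
    have e1 := hz q hq
    have e2 := hz' q hq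
    simp only at e1 e2
    simp only [Prod.snd_add, inner_add_left, map_add, e1, e2]
  smul_mem' := by
    rintro c p ⟨y, hy, hz⟩
    refine ⟨(starRingEnd ℂ) c • y, relativeTomitaGraph_smul c hy, fun q hq => ?_⟩
    have e := hz q hq
    simp only at e
    simp only [Prod.smul_snd, inner_smul_left, map_mul, e]

/-- The relative modular operator `Δ_{Ψ|Φ} = S_{Ψ|Φ}† S_{Ψ|Φ}`, as a partially defined operator. -/
noncomputable def relativeModularOperator (M : VonNeumannAlgebra H) (Ψ Φ : H) : H →ₗ.[ℂ] H :=
  (relativeModularGraph M Ψ Φ).toLinearPMap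

end Vectors

/-! ### Projection valued measures -/

/-- A projection valued measure on the Borel sets of `ℝ`, extended by zero to other sets. -/
structure ProjectionValuedMeasure (H : Type*) [NormedAddCommGroup H] [InnerProductSpace ℂ H]
    [CompleteSpace H] where
  /-- The projection attached to a set. -/
  proj : Set ℝ → (H →L[ℂ] H)
  isStarProjection' : ∀ s, MeasurableSet s → IsStarProjection (proj s)
  not_measurable' : ∀ s, ¬ MeasurableSet s → proj s = 0
  empty' : proj ∅ = 0
  univ' : proj Set.univ = 1
  inter' : ∀ s t, MeasurableSet s → MeasurableSet t → proj s * proj t = proj (s ∩ t)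
  iUnion' : ∀ s : ℕ → Set ℝ, (∀ n, MeasurableSet (s n)) →
    (∀ m n, m ≠ n → s m ∩ s n = ∅) → ∀ x : H,
      Filter.Tendsto (fun N : ℕ => ∑ n ∈ Finset.range N, proj (s n) x) Filter.atTop
        (nhds (proj (⋃ n, s n) x))

namespace ProjectionValuedMeasure

variable {H : Type*} [NormedAddCommGroup H] [InnerProductSpace ℂ H] [CompleteSpace H]

theorem re_inner_nonneg (P : ProjectionValuedMeasure H) (x : H) {s : Set ℝ}
    (hs : MeasurableSet s) : 0 ≤ (⟪x, P.proj s x⟫_ℂ).re := by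
  have hp := P.isStarProjection' s hs
  have h1 : P.proj s (P.proj s x) = P.proj s x := by
    have h := congrArg (fun T : H →L[ℂ] H => T x) hp.isIdempotentElem.eq
    simpa using h
  have h2 : ⟪P.proj s x, P.proj s x⟫_ℂ = ⟪x, P.proj s (P.proj s x)⟫_ℂ := by
    have h := ContinuousLinearMap.adjoint_inner_left (P.proj s) (P.proj s x) x
    rwa [← ContinuousLinearMap.star_eq_adjoint, hp.isSelfAdjoint.star_eq] at h
  have h3 : 0 ≤ (⟪P.proj s x, P.proj s x⟫_ℂ).re := inner_self_nonneg (𝕜 := ℂ)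
  rwa [h2, h1] at h3

/-- The Borel measure `B ↦ ⟪x, P_B x⟫` on `ℝ`. -/
noncomputable def scalarMeasure (P : ProjectionValuedMeasure H) (x : H) :
    MeasureTheory.Measure ℝ :=
  MeasureTheory.Measure.ofMeasurable (fun s _ => ENNReal.ofReal (⟪x, P.proj s x⟫_ℂ).re)
    (by simp [P.empty']) (by
      intro s hs hd
      have hdisj : ∀ m n, m ≠ n → s m ∩ s n = ∅ := fun m n hmn =>
        Set.disjoint_iff_inter_eq_empty.mp (hd hmn)
      have ht : Filter.Tendsto
          (fun N : ℕ => ∑ n ∈ Finset.range N, (⟪x, P.proj (s n) x⟫_ℂ).re) Filter.atTop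
          (nhds (⟪x, P.proj (⋃ n, s n) x⟫_ℂ).re) := by
        have h := (Complex.continuous_re.tendsto _).comp
          ((tendsto_const_nhds (x := x)).inner (𝕜 := ℂ) (P.iUnion' s hs hdisj x))
        refine h.congr fun N => ?_
        simp [inner_sum, Complex.re_sum]
      have hsum : HasSum (fun n => (⟪x, P.proj (s n) x⟫_ℂ).re)
          (⟪x, P.proj (⋃ n, s n) x⟫_ℂ).re :=
        (hasSum_iff_tendsto_nat_of_nonneg (fun n => P.re_inner_nonneg x (hs n)) _).mpr ht
      rw [← hsum.tsum_eq]
      exact ENNReal.ofReal_tsum_of_nonneg (fun n => P.re_inner_nonneg x (hs n)) hsum.summable)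

/-- `A = ∫ t dP(t)`: the domain of `A` is the set of all `x` with `∫ t² d⟪x, P x⟫ < ∞`, and
`⟪x, A x⟫ = ∫ t d⟪x, P x⟫` on it (by polarization, this determines `A`). -/
def IsSpectralMeasureOf (P : ProjectionValuedMeasure H) (A : H →ₗ.[ℂ] H) : Prop :=
  (∀ x : H, x ∈ A.domain ↔ ∫⁻ t, ENNReal.ofReal (t ^ 2) ∂(P.scalarMeasure x) < ∞) ∧
  ∀ x : A.domain, ⟪(x : H), A x⟫_ℂ = ((∫ t, t ∂(P.scalarMeasure (x : H)) : ℝ) : ℂ)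

/-- `∫_{[0,∞)} log t d⟪x, P x⟫` as an extended real number, with `log 0 = -∞`: the integral of the
positive part of the logarithm minus the integral of its negative part. -/
noncomputable def logIntegral (P : ProjectionValuedMeasure H) (x : H) : EReal :=
  ((∫⁻ t in Set.Ici (0 : ℝ), (ENNReal.log (ENNReal.ofReal t)).toENNReal
      ∂(P.scalarMeasure x) : ℝ≥0∞) : EReal) -
  ((∫⁻ t in Set.Ici (0 : ℝ), (-ENNReal.log (ENNReal.ofReal t)).toENNReal
      ∂(P.scalarMeasure x) : ℝ≥0∞) : EReal)

end ProjectionValuedMeasure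

/-! ### Relative entropy -/

/-- `s` is the relative entropy `-⟪Ψ, log Δ_{Ψ|Φ} Ψ⟫` with respect to `M`: the vector `Ψ` is cyclic
and separating for `M`, the relative modular operator has exactly one spectral measure `P`, and
`s = -∫ log t d⟪Ψ, P Ψ⟫`. In particular there is at most one such `s`. -/
def IsRelativeEntropy {H : Type*} [NormedAddCommGroup H] [InnerProductSpace ℂ H] [CompleteSpace H]
    (M : VonNeumannAlgebra H) (Ψ Φ : H) (s : EReal) : Prop :=
  IsCyclicVector M Ψ ∧ IsSeparatingVector M Ψ ∧
  ∃ P : ProjectionValuedMeasure H,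
    P.IsSpectralMeasureOf (relativeModularOperator M Ψ Φ) ∧
    (∀ Q : ProjectionValuedMeasure H,
      Q.IsSpectralMeasureOf (relativeModularOperator M Ψ Φ) → Q = P) ∧
    s = -P.logIntegral Ψ

/-! ### Orbits of vectors under a von Neumann algebra -/

section Orbit

open Filter Topology

/-! The isometry carries every structure that enters the entropy, although its range may be a proper
subspace. If `O ∈ M` is implemented by `T ∈ N` together with its adjoint, then `u` sends the pair
`(O Ψ, O† Φ)` to `(T u Ψ, T† u Φ)`. Passing to limits, `u` maps the graph of `S_{Ψ|Φ}` into the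
graph of `S_{uΨ|uΦ}`, and the same holds for the commutants.

For `Δ = S† S` the adjoint must be transported too. Inclusions of graphs reverse under adjoints, so
this does not follow from the inclusion for `S` alone. The remedy is the identity `S_{Ψ|Φ}(M)† =
S_{Ψ|Φ}(M')` (`conjAdjointGraph_relativeTomitaGraph`), which turns the inclusion for the commutants
into one for the adjoints. Hence `u Δ_{Ψ|Φ} ⊆ Δ_{uΨ|uΦ} u` (`map_mem_relativeModularGraph`).

A bounded intertwiner of two operators with spectral measures intertwines those measures
(`proj_apply_map`). Since `u` preserves norms, the scalar spectral measures at `Ψ` and `u Ψ`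
coincide, and so do the integrals of the logarithm. The same fact with the identity as intertwiner
gives uniqueness of the spectral measure. Existence (`exists_isSpectralMeasureOf`) comes from the
bounded self-adjoint operator `(1 + Δ)⁻¹`, by Riesz–Markov and the continuous functional calculus.

Cyclicity of `u Ψ` cannot be pushed forward through a map that is not surjective. Instead `u Ψ` is
shown to be separating for both `N` and `N'` (`isSeparatingVector_map`), and cyclicity follows by
duality. -/

theorem isClosed_conjAdjointGraph {E : Type*} [NormedAddCommGroup E] [InnerProductSpace ℂ E]
    (S : Set (E × E)) : IsClosed (conjAdjointGraph S) := by
  simp only [conjAdjointGraph, Set.ofPred_forall]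
  exact isClosed_iInter fun p => isClosed_iInter fun _ =>
    isClosed_eq (by fun_prop) (Complex.continuous_conj.comp (by fun_prop))

variable {H : Type*} [NormedAddCommGroup H] [InnerProductSpace ℂ H] [CompleteSpace H]

/-- The subspace `M v` of all `O v` with `O ∈ M`. -/
def vonNeumannOrbit (M : VonNeumannAlgebra H) (v : H) : Submodule ℂ H where
  carrier := {x : H | ∃ O ∈ M, O v = x}
  zero_mem' := ⟨0, zero_mem M, rfl⟩
  add_mem' := by
    rintro _ _ ⟨O, hO, rfl⟩ ⟨O', hO', rfl⟩
    exact ⟨O + O', add_mem hO hO', rfl⟩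
  smul_mem' := by
    rintro c _ ⟨O, hO, rfl⟩
    exact ⟨c • O, M.toStarSubalgebra.smul_mem hO c, rfl⟩

theorem apply_mem_vonNeumannOrbit {M : VonNeumannAlgebra H} {O : H →L[ℂ] H} (hO : O ∈ M) (v : H) :
    O v ∈ vonNeumannOrbit M v :=
  ⟨O, hO, rfl⟩

theorem self_mem_vonNeumannOrbit (M : VonNeumannAlgebra H) (v : H) : v ∈ vonNeumannOrbit M v :=
  ⟨1, one_mem M, rfl⟩

theorem mul_comm_of_mem_commutant {M : VonNeumannAlgebra H} {O T : H →L[ℂ] H} (hO : O ∈ M)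
    (hT : T ∈ M.commutant) (x : H) : O (T x) = T (O x) :=
  congrArg (fun S : H →L[ℂ] H => S x) (VonNeumannAlgebra.mem_commutant_iff.mp hT O hO)

theorem starProjection_vonNeumannOrbit_mem (M : VonNeumannAlgebra H) (v : H) :
    (vonNeumannOrbit M v).topologicalClosure.starProjection ∈ M.commutant := by
  rw [VonNeumannAlgebra.IsStarProjection.mem_iff isStarProjection_starProjection]
  intro T hT
  rw [VonNeumannAlgebra.commutant_commutant] at hT
  rw [Submodule.range_starProjection, Module.End.mem_invtSubmodule]
  intro x hx
  rw [Submodule.mem_comap]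
  refine map_mem_closure T.continuous hx ?_
  rintro _ ⟨O, hO, rfl⟩
  exact ⟨T * O, mul_mem hT hO, rfl⟩

theorem IsCyclicVector.isSeparatingVector_commutant {M : VonNeumannAlgebra H} {v : H}
    (h : IsCyclicVector M v) : IsSeparatingVector M.commutant v := by
  intro T hT hTv
  have : (T : H → H) = (0 : H →L[ℂ] H) := by
    refine Continuous.ext_on h T.continuous continuous_const ?_
    rintro _ ⟨O, hO, rfl⟩
    rw [← mul_comm_of_mem_commutant hO hT, hTv, map_zero]
    rfl
  exact DFunLike.coe_injective this

/-- The projection `p` onto the closure of `M' v` lies in `M'' = M`, and `1 - p` annihilates `v`, so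
`p = 1`. -/
theorem IsSeparatingVector.isCyclicVector_commutant {M : VonNeumannAlgebra H} {v : H}
    (h : IsSeparatingVector M v) : IsCyclicVector M.commutant v := by
  set K := (vonNeumannOrbit M.commutant v).topologicalClosure with hK
  have hP : K.starProjection ∈ M := by
    have := starProjection_vonNeumannOrbit_mem M.commutant v
    rwa [VonNeumannAlgebra.commutant_commutant] at this
  have h1 : 1 - K.starProjection = 0 := by
    refine h _ (sub_mem (one_mem M) hP) ?_
    have hv : v ∈ K := Submodule.le_topologicalClosure _ (self_mem_vonNeumannOrbit _ v)
    simp [Submodule.starProjection_eq_self_iff.mpr hv]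
  intro x
  have h2 : K.starProjection x = x := by
    have := congrArg (fun S : H →L[ℂ] H => S x) h1
    exact (sub_eq_zero.mp this).symm
  exact Submodule.starProjection_eq_self_iff.mp h2

theorem IsSeparatingVector.isCyclicVector {M : VonNeumannAlgebra H} {v : H}
    (h : IsSeparatingVector M.commutant v) : IsCyclicVector M v := by
  simpa using h.isCyclicVector_commutant

/-! ### The adjoint of the relative Tomita operator -/

/-- In a metric space sequential limits give the closure, so closed conditions on the graph need
only be checked on the pairs `(O Ψ, O† Φ)`. -/
theorem mem_relativeTomitaGraph_iff {M : VonNeumannAlgebra H} {Ψ Φ : H} {p : H × H} :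
    p ∈ relativeTomitaGraph M Ψ Φ ↔
      p ∈ closure {q : H × H | ∃ O ∈ M, (O Ψ, star O Φ) = q} := by
  rw [mem_closure_iff_seq_limit]
  constructor
  · rintro ⟨O, hO, h1, h2⟩
    exact ⟨fun n => (O n Ψ, star (O n) Φ), fun n => ⟨O n, hO n, rfl⟩, h1.prodMk_nhds h2⟩
  · rintro ⟨q, hq, h⟩
    choose O hO hOq using hq
    refine ⟨O, hO, ?_, ?_⟩
    · simpa [← hOq, Function.comp_def] using (continuous_fst.tendsto p).comp h
    · simpa [← hOq, Function.comp_def] using (continuous_snd.tendsto p).comp h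

theorem isClosed_relativeTomitaGraph (M : VonNeumannAlgebra H) (Ψ Φ : H) :
    IsClosed (relativeTomitaGraph M Ψ Φ) := by
  have : relativeTomitaGraph M Ψ Φ = closure {q : H × H | ∃ O ∈ M, (O Ψ, star O Φ) = q} :=
    Set.ext fun _ => mem_relativeTomitaGraph_iff
  rw [this]
  exact isClosed_closure

theorem apply_mem_relativeTomitaGraph {M : VonNeumannAlgebra H} {O : H →L[ℂ] H} (hO : O ∈ M)
    (Ψ Φ : H) : (O Ψ, star O Φ) ∈ relativeTomitaGraph M Ψ Φ :=
  mem_relativeTomitaGraph_iff.mpr (subset_closure ⟨O, hO, rfl⟩)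

theorem mem_conjAdjointGraph_relativeTomitaGraph_iff {M : VonNeumannAlgebra H} {Ψ Φ : H}
    {q : H × H} : q ∈ conjAdjointGraph (relativeTomitaGraph M Ψ Φ) ↔
      ∀ O ∈ M, ⟪q.1, star O Φ⟫_ℂ = (starRingEnd ℂ) ⟪q.2, O Ψ⟫_ℂ := by
  refine ⟨fun h O hO => h _ (apply_mem_relativeTomitaGraph hO Ψ Φ), fun h p hp => ?_⟩
  have hcl : IsClosed {p : H × H | ⟪q.1, p.2⟫_ℂ = (starRingEnd ℂ) ⟪q.2, p.1⟫_ℂ} :=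
    isClosed_eq (by fun_prop) (Complex.continuous_conj.comp (by fun_prop))
  refine closure_minimal ?_ hcl (mem_relativeTomitaGraph_iff.mp hp)
  rintro _ ⟨O, hO, rfl⟩
  exact h O hO

theorem star_inner_left (T : H →L[ℂ] H) (x y : H) : ⟪star T x, y⟫_ℂ = ⟪x, T y⟫_ℂ := by
  rw [ContinuousLinearMap.star_eq_adjoint, ContinuousLinearMap.adjoint_inner_left]

theorem star_inner_right (T : H →L[ℂ] H) (x y : H) : ⟪x, star T y⟫_ℂ = ⟪T x, y⟫_ℂ := by
  rw [ContinuousLinearMap.star_eq_adjoint, ContinuousLinearMap.adjoint_inner_right]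

/-- The easy half of the adjoint theorem: for `O ∈ M` and `T ∈ M'` it is the identity `⟪T Ψ, O† Φ⟫ =
⟪T O Ψ, Φ⟫ = ⟪O Ψ, T† Φ⟫`. -/
theorem relativeTomitaGraph_commutant_subset (M : VonNeumannAlgebra H) (Ψ Φ : H) :
    relativeTomitaGraph M.commutant Ψ Φ ⊆ conjAdjointGraph (relativeTomitaGraph M Ψ Φ) := by
  intro p hp
  refine closure_minimal ?_ (isClosed_conjAdjointGraph _) (mem_relativeTomitaGraph_iff.mp hp)
  rintro _ ⟨T, hT, rfl⟩
  rw [mem_conjAdjointGraph_relativeTomitaGraph_iff]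
  intro O hO
  simp only
  rw [star_inner_right, star_inner_left, mul_comm_of_mem_commutant hO hT, inner_conj_symm,
    ← star_inner_right, ← star_inner_right]

end Orbit

/-! ### The hard inclusion `S† ⊆ S'`, by projections onto graphs. -/

section TomitaAdjoint

open Filter Topology

variable {H : Type*} [NormedAddCommGroup H] [InnerProductSpace ℂ H] [CompleteSpace H]

/-- The closure of the graph of the operator `O Ψ ↦ ε O y`, `O ∈ M`. -/
noncomputable def orbitGraph (M : VonNeumannAlgebra H) (Ψ y : H) (ε : ℝ) :
    Submodule ℂ (WithLp 2 (H × H)) :=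
  Submodule.topologicalClosure
    { carrier := {p | ∃ O ∈ M, WithLp.toLp 2 (O Ψ, (ε : ℂ) • O y) = p}
      zero_mem' := ⟨0, zero_mem M, by simp⟩
      add_mem' := by
        rintro _ _ ⟨O, hO, rfl⟩ ⟨O', hO', rfl⟩
        exact ⟨O + O', add_mem hO hO', by simp [← WithLp.toLp_add]⟩
      smul_mem' := by
        rintro c _ ⟨O, hO, rfl⟩
        exact ⟨c • O, M.toStarSubalgebra.smul_mem hO c, by simp [← WithLp.toLp_smul, smul_comm c]⟩ }

instance (M : VonNeumannAlgebra H) (Ψ y : H) (ε : ℝ) : CompleteSpace (orbitGraph M Ψ y ε) :=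
  (Submodule.isClosed_topologicalClosure _).completeSpace_coe

theorem toLp_mem_orbitGraph {M : VonNeumannAlgebra H} {O : H →L[ℂ] H} (hO : O ∈ M) (Ψ y : H)
    (ε : ℝ) : WithLp.toLp 2 (O Ψ, (ε : ℂ) • O y) ∈ orbitGraph M Ψ y ε :=
  Submodule.le_topologicalClosure _ ⟨O, hO, rfl⟩

theorem orbitGraph_induction {M : VonNeumannAlgebra H} {Ψ y : H} {ε : ℝ}
    {s : Set (WithLp 2 (H × H))} (hs : IsClosed s)
    (h : ∀ O ∈ M, WithLp.toLp 2 (O Ψ, (ε : ℂ) • O y) ∈ s) {k : WithLp 2 (H × H)}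
    (hk : k ∈ orbitGraph M Ψ y ε) : k ∈ s := by
  refine closure_minimal ?_ hs hk
  rintro _ ⟨O, hO, rfl⟩
  exact h O hO

/-- The inclusion of the first factor into the Hilbert sum. -/
noncomputable def inlL2 (H : Type*) [NormedAddCommGroup H] [InnerProductSpace ℂ H] :
    H →L[ℂ] WithLp 2 (H × H) :=
  (WithLp.prodContinuousLinearEquiv 2 ℂ H H).symm.toContinuousLinearMap ∘L
    ContinuousLinearMap.inl ℂ H H

/-- The upper left corner of the projection onto `orbitGraph`. -/
noncomputable def orbitGraphFst (M : VonNeumannAlgebra H) (Ψ y : H) (ε : ℝ) : H →L[ℂ] H :=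
  WithLp.fstL 2 ℂ H H ∘L (orbitGraph M Ψ y ε).starProjection ∘L inlL2 H

/-- The lower left corner of the projection onto `orbitGraph`. -/
noncomputable def orbitGraphSnd (M : VonNeumannAlgebra H) (Ψ y : H) (ε : ℝ) : H →L[ℂ] H :=
  WithLp.sndL 2 ℂ H H ∘L (orbitGraph M Ψ y ε).starProjection ∘L inlL2 H

variable (M : VonNeumannAlgebra H) (Ψ y : H) (ε : ℝ)

theorem starProjection_orbitGraph_inlL2 (w : H) :
    (orbitGraph M Ψ y ε).starProjection (WithLp.toLp 2 (w, 0)) =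
      WithLp.toLp 2 (orbitGraphFst M Ψ y ε w, orbitGraphSnd M Ψ y ε w) := rfl

theorem toLp_orbitGraphFst_mem (w : H) :
    WithLp.toLp 2 (orbitGraphFst M Ψ y ε w, orbitGraphSnd M Ψ y ε w) ∈ orbitGraph M Ψ y ε := by
  rw [← starProjection_orbitGraph_inlL2]
  exact Submodule.starProjection_apply_mem _ _

theorem inner_orbitGraph_right {M : VonNeumannAlgebra H} {O : H →L[ℂ] H} (hO : O ∈ M) (w : H) :
    ⟪w - orbitGraphFst M Ψ y ε w, O Ψ⟫_ℂ = ε * ⟪orbitGraphSnd M Ψ y ε w, O y⟫_ℂ := by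
  have h := Submodule.starProjection_inner_eq_zero (K := orbitGraph M Ψ y ε)
    (WithLp.toLp 2 (w, 0)) _ (toLp_mem_orbitGraph hO Ψ y ε)
  rw [starProjection_orbitGraph_inlL2, ← WithLp.toLp_sub, WithLp.prod_inner_apply] at h
  simp only [Prod.mk_sub_mk, zero_sub, inner_neg_left, inner_smul_right] at h
  rwa [mul_neg, ← sub_eq_add_neg, sub_eq_zero] at h

variable {M Ψ y ε} in
theorem toLp_apply_mem_orbitGraph {k : WithLp 2 (H × H)} (hk : k ∈ orbitGraph M Ψ y ε)
    {O : H →L[ℂ] H} (hO : O ∈ M) : WithLp.toLp 2 (O k.fst, O k.snd) ∈ orbitGraph M Ψ y ε := by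
  have hcl : IsClosed {k : WithLp 2 (H × H) |
      WithLp.toLp 2 (O k.fst, O k.snd) ∈ orbitGraph M Ψ y ε} := by
    refine (Submodule.isClosed_topologicalClosure _).preimage ?_
    refine (WithLp.prod_continuous_toLp 2 H H).comp ?_
    exact (O.continuous.comp (WithLp.continuous_fst 2 H H)).prodMk
      (O.continuous.comp (WithLp.continuous_snd 2 H H))
  refine orbitGraph_induction hcl (fun A hA => ?_) hk
  simpa using toLp_mem_orbitGraph (mul_mem hO hA) Ψ y ε

/-- The graph is invariant under the diagonal action of the self-adjoint algebra `M`. Its projection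
therefore commutes with that action, and so does each corner. -/
theorem orbitGraphSnd_mem_commutant : orbitGraphSnd M Ψ y ε ∈ M.commutant := by
  rw [VonNeumannAlgebra.mem_commutant_iff]
  intro O hO
  ext w
  have hmem := toLp_apply_mem_orbitGraph (toLp_orbitGraphFst_mem M Ψ y ε w) hO
  simp only [WithLp.toLp_fst, WithLp.toLp_snd] at hmem
  have h := Submodule.eq_starProjection_of_mem_of_inner_eq_zero (u := WithLp.toLp 2 (O w, 0))
    hmem (fun k hk => by
      have hcl : IsClosed {k : WithLp 2 (H × H) | ⟪(WithLp.toLp 2 (O w, 0) : WithLp 2 (H × H)) -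
          WithLp.toLp 2 (O (orbitGraphFst M Ψ y ε w), O (orbitGraphSnd M Ψ y ε w)), k⟫_ℂ = 0} :=
        isClosed_eq (by fun_prop) continuous_const
      refine orbitGraph_induction hcl (fun A hA => ?_) hk
      have h1 := inner_orbitGraph_right Ψ y ε (mul_mem (star_mem hO) hA) w
      simp only [mul_apply_eq_comp, star_inner_right, map_sub] at h1
      simp only [Set.mem_ofPred_eq]
      rw [← WithLp.toLp_sub, WithLp.prod_inner_apply]
      simp only [Prod.mk_sub_mk, zero_sub, inner_neg_left, inner_smul_right]
      rw [h1, mul_neg, add_neg_cancel])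
  rw [starProjection_orbitGraph_inlL2] at h
  have := congrArg WithLp.snd h
  simpa using this.symm

theorem inner_orbitGraphFst (v w : H) :
    ⟪orbitGraphFst M Ψ y ε v, w⟫_ℂ = ⟪v, orbitGraphFst M Ψ y ε w⟫_ℂ := by
  have h := Submodule.inner_starProjection_left_eq_right (orbitGraph M Ψ y ε)
    (WithLp.toLp 2 (v, 0)) (WithLp.toLp 2 (w, 0))
  simpa [starProjection_orbitGraph_inlL2, WithLp.prod_inner_apply] using h

/-- The projection of `(O Ψ, 0)` is its nearest point in the graph; the competitor is `(O Ψ, ε O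
y)`. -/
theorem norm_orbitGraph_le {M : VonNeumannAlgebra H} {O : H →L[ℂ] H} (hO : O ∈ M) :
    ‖O Ψ - orbitGraphFst M Ψ y ε (O Ψ)‖ ^ 2 + ‖orbitGraphSnd M Ψ y ε (O Ψ)‖ ^ 2 ≤
      ε ^ 2 * ‖O y‖ ^ 2 := by
  have h1 := Submodule.starProjection_minimal (U := orbitGraph M Ψ y ε) (WithLp.toLp 2 (O Ψ, 0))
  have h2 := h1.trans_le (ciInf_le ⟨0, by rintro _ ⟨x, rfl⟩; exact norm_nonneg _⟩
    ⟨_, toLp_mem_orbitGraph hO Ψ y ε⟩)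
  have h3 := pow_le_pow_left₀ (norm_nonneg _) h2 2
  rw [starProjection_orbitGraph_inlL2, ← WithLp.toLp_sub, ← WithLp.toLp_sub,
    WithLp.prod_norm_sq_eq_of_L2, WithLp.prod_norm_sq_eq_of_L2] at h3
  simpa [norm_smul, mul_pow] using h3

theorem norm_orbitGraphFst_le (w : H) : ‖orbitGraphFst M Ψ y ε w‖ ≤ ‖w‖ := by
  have h1 := Submodule.norm_starProjection_apply_le (orbitGraph M Ψ y ε) (WithLp.toLp 2 (w, 0))
  rw [starProjection_orbitGraph_inlL2] at h1
  have h2 := pow_le_pow_left₀ (norm_nonneg _) h1 2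
  rw [WithLp.prod_norm_sq_eq_of_L2, WithLp.prod_norm_sq_eq_of_L2] at h2
  simp at h2
  refine abs_le_of_sq_le_sq' ?_ (norm_nonneg _) |>.2
  nlinarith [sq_nonneg ‖orbitGraphSnd M Ψ y ε w‖]

variable {M Ψ y}

/-- The upper left corners are contractions, and on the dense set `M Ψ` they differ from the
identity by at most `|ε| ‖O y‖`. -/
theorem tendsto_orbitGraphFst (h : IsCyclicVector M Ψ) {e : ℕ → ℝ} (he : Tendsto e atTop (𝓝 0))
    (w : H) : Tendsto (fun n => orbitGraphFst M Ψ y (e n) w) atTop (𝓝 w) := by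
  rw [Metric.tendsto_atTop]
  intro δ hδ
  obtain ⟨_, ⟨O, hO, rfl⟩, hw⟩ := Dense.exists_dist_lt h w (show 0 < δ / 3 by positivity)
  rw [dist_eq_norm, norm_sub_rev] at hw
  have hlim : Tendsto (fun n => |e n| * ‖O y‖) atTop (𝓝 0) := by
    simpa using he.abs.mul_const ‖O y‖
  obtain ⟨N, hN⟩ := (Metric.tendsto_atTop.mp hlim) (δ / 3) (by positivity)
  refine ⟨N, fun n hn => ?_⟩
  have h1 := hN n hn
  rw [Real.dist_eq, sub_zero, abs_of_nonneg (by positivity)] at h1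
  have h2 : ‖O Ψ - orbitGraphFst M Ψ y (e n) (O Ψ)‖ ≤ |e n| * ‖O y‖ := by
    refine abs_le_of_sq_le_sq' ?_ (by positivity) |>.2
    rw [mul_pow, sq_abs]
    nlinarith [norm_orbitGraph_le Ψ y (e n) hO, sq_nonneg ‖orbitGraphSnd M Ψ y (e n) (O Ψ)‖]
  have h3 := norm_orbitGraphFst_le M Ψ y (e n) (w - O Ψ)
  rw [norm_sub_rev w] at h3
  rw [dist_eq_norm]
  calc ‖orbitGraphFst M Ψ y (e n) w - w‖
      = ‖orbitGraphFst M Ψ y (e n) (w - O Ψ) - (O Ψ - orbitGraphFst M Ψ y (e n) (O Ψ)) +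
          (O Ψ - w)‖ := by rw [map_sub]; congr 1; abel
    _ ≤ ‖orbitGraphFst M Ψ y (e n) (w - O Ψ)‖ + ‖O Ψ - orbitGraphFst M Ψ y (e n) (O Ψ)‖ +
          ‖O Ψ - w‖ := (norm_add_le _ _).trans (by gcongr; exact norm_sub_le _ _)
    _ < δ := by linarith

/-- A sequence that is bounded by the norm of `y` and converges to `y` weakly on a subspace whose
closure contains `y` converges to `y` in norm. -/
theorem tendsto_of_weak_of_norm_le {E : Type*} [NormedAddCommGroup E] [InnerProductSpace ℂ E]
    {b : ℕ → E} {y : E} {s : Set E} (hb : ∀ n, ‖b n‖ ≤ ‖y‖) (hy : y ∈ closure s)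
    (hw : ∀ v ∈ s, Tendsto (fun n => ⟪v, b n⟫_ℂ) atTop (𝓝 ⟪v, y⟫_ℂ)) :
    Tendsto b atTop (𝓝 y) := by
  have key : Tendsto (fun n => ⟪y, b n⟫_ℂ) atTop (𝓝 ⟪y, y⟫_ℂ) := by
    rw [Metric.tendsto_atTop]
    intro δ hδ
    obtain ⟨v, hv, hvy⟩ := Metric.mem_closure_iff.mp hy (δ / (3 * (‖y‖ + 1))) (by positivity)
    rw [dist_eq_norm, lt_div_iff₀ (by positivity)] at hvy
    obtain ⟨N, hN⟩ := (Metric.tendsto_atTop.mp (hw v hv)) (δ / 3) (by positivity)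
    refine ⟨N, fun n hn => ?_⟩
    have h1 := hN n hn
    rw [dist_eq_norm] at h1 ⊢
    have h2 : ‖⟪y - v, b n⟫_ℂ‖ ≤ ‖y - v‖ * ‖y‖ :=
      (norm_inner_le_norm _ _).trans (by gcongr; exact hb n)
    have h3 : ‖⟪y - v, y⟫_ℂ‖ ≤ ‖y - v‖ * ‖y‖ := norm_inner_le_norm _ _
    have h4 := norm_nonneg (y - v)
    calc ‖⟪y, b n⟫_ℂ - ⟪y, y⟫_ℂ‖
        = ‖⟪y - v, b n⟫_ℂ + (⟪v, b n⟫_ℂ - ⟪v, y⟫_ℂ) - ⟪y - v, y⟫_ℂ‖ := by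
          simp only [inner_sub_left]; congr 1; ring
      _ ≤ ‖⟪y - v, b n⟫_ℂ‖ + ‖⟪v, b n⟫_ℂ - ⟪v, y⟫_ℂ‖ + ‖⟪y - v, y⟫_ℂ‖ :=
          (norm_sub_le _ _).trans (by gcongr; exact norm_add_le _ _)
      _ < δ := by nlinarith
  -- Twice this difference dominates `‖b n - y‖ ^ 2`, because `‖b n‖ ≤ ‖y‖`.
  have key2 : Tendsto (fun n => 2 * ((⟪y, y⟫_ℂ).re - (⟪y, b n⟫_ℂ).re)) atTop (𝓝 0) := by
    have h := (Complex.continuous_re.tendsto _).comp key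
    simpa using (h.const_sub (⟪y, y⟫_ℂ).re).const_mul 2
  have hsq : Tendsto (fun n => ‖b n - y‖ ^ 2) atTop (𝓝 0) := by
    refine squeeze_zero (fun n => by positivity) (fun n => ?_) key2
    rw [norm_sub_rev, norm_sub_sq (𝕜 := ℂ)]
    have h5 := pow_le_pow_left₀ (norm_nonneg _) (hb n) 2
    have h6 : (⟪y, y⟫_ℂ).re = ‖y‖ ^ 2 := inner_self_eq_norm_sq (𝕜 := ℂ) y
    have h7 : RCLike.re ⟪y, b n⟫_ℂ = (⟪y, b n⟫_ℂ).re := rfl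
    rw [h6, h7]
    linarith
  rw [tendsto_iff_norm_sub_tendsto_zero]
  simpa [Function.comp_def] using (Real.continuous_sqrt.tendsto 0).comp hsq

/-- On the pairs `(A Ψ, ε A y)` this is the adjoint relation for `(y, z)` tested against `O† A`; it
extends to the closure by continuity. -/
theorem inner_orbitGraph_left {Φ z : H}
    (hyz : (y, z) ∈ conjAdjointGraph (relativeTomitaGraph M Ψ Φ)) {O : H →L[ℂ] H} (hO : O ∈ M)
    {k : WithLp 2 (H × H)} (hk : k ∈ orbitGraph M Ψ y ε) :
    ⟪O Φ, k.snd⟫_ℂ = ε * ⟪O z, k.fst⟫_ℂ := by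
  rw [mem_conjAdjointGraph_relativeTomitaGraph_iff] at hyz
  have hcl : IsClosed {k : WithLp 2 (H × H) | ⟪O Φ, k.snd⟫_ℂ = ε * ⟪O z, k.fst⟫_ℂ} := by
    have h1 := WithLp.continuous_fst 2 H H
    have h2 := WithLp.continuous_snd 2 H H
    exact isClosed_eq (by fun_prop) (by fun_prop)
  refine orbitGraph_induction hcl (fun A hA => ?_) hk
  have h := congrArg (starRingEnd ℂ) (hyz (star O * A) (mul_mem (star_mem hO) hA))
  simp only [star_mul, star_star, mul_apply_eq_comp, inner_conj_symm, star_inner_right] at h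
  simp only [Set.mem_ofPred_eq, WithLp.toLp_fst, WithLp.toLp_snd, inner_smul_right]
  rw [← h]

/-- The approximants are `T = ε⁻¹ b`, where `b` is the lower left corner and `a` the upper left one.
Then `T† Φ = a z → z`, while `⟪O Φ, T Ψ⟫ = ⟪O z, a Ψ⟫ → ⟪O Φ, y⟫` and `‖T Ψ‖ ≤ ‖y‖`. The weak limit
is tested only on `M Φ`, hence the assumption that `y` lies in its closure. -/
theorem mem_relativeTomitaGraph_commutant_of_mem_closure {Φ z : H} (h : IsCyclicVector M Ψ)
    (hyz : (y, z) ∈ conjAdjointGraph (relativeTomitaGraph M Ψ Φ))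
    (hy : y ∈ closure (vonNeumannOrbit M Φ : Set H)) :
    (y, z) ∈ relativeTomitaGraph M.commutant Ψ Φ := by
  set e : ℕ → ℝ := fun n => 1 / ((n : ℝ) + 1) with he_def
  have he : Tendsto e atTop (𝓝 0) := tendsto_one_div_add_atTop_nhds_zero_nat
  have hpos : ∀ n, 0 < e n := fun n => by positivity
  refine ⟨fun n => ((e n : ℂ)⁻¹) • orbitGraphSnd M Ψ y (e n), fun n =>
    M.commutant.toStarSubalgebra.smul_mem (orbitGraphSnd_mem_commutant M Ψ y (e n)) _, ?_, ?_⟩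
  · refine tendsto_of_weak_of_norm_le (s := vonNeumannOrbit M Φ) (fun n => ?_) hy ?_
    · have h1 := norm_orbitGraph_le Ψ y (e n) (one_mem M)
      simp only [one_apply_eq_self] at h1
      simp only [smul_apply, norm_smul, norm_inv, Complex.norm_real,
        Real.norm_eq_abs, abs_of_pos (hpos n)]
      rw [inv_mul_le_iff₀ (hpos n)]
      refine abs_le_of_sq_le_sq' ?_ (by have := hpos n; positivity) |>.2
      rw [mul_pow]
      nlinarith [sq_nonneg ‖Ψ - orbitGraphFst M Ψ y (e n) Ψ‖]
    · rintro _ ⟨O, hO, rfl⟩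
      have h1 : ∀ n, ⟪O Φ, (((e n : ℂ)⁻¹) • orbitGraphSnd M Ψ y (e n)) Ψ⟫_ℂ =
          ⟪O z, orbitGraphFst M Ψ y (e n) Ψ⟫_ℂ := fun n => by
        have := inner_orbitGraph_left (e n) hyz hO (toLp_orbitGraphFst_mem M Ψ y (e n) Ψ)
        simp only [WithLp.toLp_fst, WithLp.toLp_snd] at this
        rw [smul_apply, inner_smul_right, this, inv_mul_cancel_left₀]
        exact_mod_cast (hpos n).ne'
      have h2 : ⟪O Φ, y⟫_ℂ = ⟪O z, Ψ⟫_ℂ := by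
        have := inner_orbitGraph_left 1 hyz hO (toLp_mem_orbitGraph (one_mem M) Ψ y 1)
        simpa using this
      simp only [h1, h2]
      exact tendsto_const_nhds.inner (tendsto_orbitGraphFst h he Ψ)
  · have h1 : ∀ n, (star (((e n : ℂ)⁻¹) • orbitGraphSnd M Ψ y (e n))) Φ =
        orbitGraphFst M Ψ y (e n) z := fun n => by
      refine ext_inner_right ℂ fun w => ?_
      have := inner_orbitGraph_left (e n) hyz (one_mem M) (toLp_orbitGraphFst_mem M Ψ y (e n) w)
      simp only [WithLp.toLp_fst, WithLp.toLp_snd, one_apply_eq_self] at this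
      rw [star_inner_left, smul_apply, inner_smul_right, this,
        inv_mul_cancel_left₀ (by exact_mod_cast (hpos n).ne'), inner_orbitGraphFst]
    simp only [h1]
    exact tendsto_orbitGraphFst h he z

theorem inner_sub_starProjection_vonNeumannOrbit {Φ : H} {O : H →L[ℂ] H} (hO : O ∈ M) (x : H) :
    ⟪x - (vonNeumannOrbit M Φ).topologicalClosure.starProjection x, O Φ⟫_ℂ = 0 :=
  Submodule.starProjection_inner_eq_zero _ _
    (Submodule.le_topologicalClosure _ (apply_mem_vonNeumannOrbit hO Φ))

/-- The adjoint of the relative Tomita operator `S_{Ψ|Φ}` of `M` is the relative Tomita operator of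
the commutant of `M`. -/
theorem conjAdjointGraph_relativeTomitaGraph {Φ : H} (h : IsCyclicVector M Ψ)
    (h' : IsCyclicVector M.commutant Ψ) :
    conjAdjointGraph (relativeTomitaGraph M Ψ Φ) = relativeTomitaGraph M.commutant Ψ Φ := by
  refine Set.Subset.antisymm ?_ (relativeTomitaGraph_commutant_subset M Ψ Φ)
  rintro ⟨y, z⟩ hyz
  set P := (vonNeumannOrbit M Φ).topologicalClosure.starProjection with hP
  have hPm : P ∈ M.commutant := starProjection_vonNeumannOrbit_mem M Φ
  have hPΦ : P Φ = Φ := Submodule.starProjection_eq_self_iff.mpr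
    (Submodule.le_topologicalClosure _ (self_mem_vonNeumannOrbit M Φ))
  have h1 : (P y, z) ∈ conjAdjointGraph (relativeTomitaGraph M Ψ Φ) := by
    rw [mem_conjAdjointGraph_relativeTomitaGraph_iff] at hyz ⊢
    intro O hO
    rw [← hyz O hO]
    have := inner_sub_starProjection_vonNeumannOrbit (Φ := Φ) (star_mem hO) y
    rw [inner_sub_left, sub_eq_zero] at this
    exact this.symm
  have h2 := mem_relativeTomitaGraph_commutant_of_mem_closure h h1
    (show P y ∈ (vonNeumannOrbit M Φ).topologicalClosure from Submodule.starProjection_apply_mem _ _)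
  -- The part of `y` orthogonal to `M Φ` is reached by `(1 - P) T` with `T Ψ` close to it: the
  -- adjoint `T† (1 - P)` kills `Φ`, so the second entry stays zero.
  have h3 : (y - P y, 0) ∈ relativeTomitaGraph M.commutant Ψ Φ := by
    obtain ⟨q, hq, hlim⟩ := mem_closure_iff_seq_limit.mp (h' (y - P y))
    choose T hT hTq using hq
    refine ⟨fun n => (1 - P) * T n, fun n => mul_mem (sub_mem (one_mem _) hPm) (hT n), ?_, ?_⟩
    · have hc : Tendsto (fun n => (1 - P) (q n)) atTop (𝓝 ((1 - P) (y - P y))) :=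
        ((1 - P).continuous.tendsto _).comp hlim
      have hPP : P (P y) = P y := Submodule.starProjection_eq_self_iff.mpr
        (Submodule.starProjection_apply_mem _ _)
      have e1 : (1 - P) (y - P y) = y - P y := by
        simp [hPP]
      rw [e1] at hc
      simpa only [mul_apply_eq_comp, hTq] using hc
    · have e2 : star P = P := isStarProjection_starProjection.isSelfAdjoint.star_eq
      have e3 : ∀ n, star ((1 - P) * T n) Φ = 0 := fun n => by
        rw [star_mul, star_sub, star_one, e2]
        simp [hPΦ]
      simp only [e3]
      exact tendsto_const_nhds
  simpa using relativeTomitaGraph_add h3 h2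

end TomitaAdjoint

/-! ### The operator `S† S`: single-valuedness, positivity, surjectivity of `1 + S† S`, transport by
`u`. -/

section ModularOperator

open Filter Topology

variable {H : Type*} [NormedAddCommGroup H] [InnerProductSpace ℂ H] [CompleteSpace H]
  {M : VonNeumannAlgebra H} {Ψ Φ : H}

theorem mem_relativeModularGraph_iff {p : H × H} : p ∈ relativeModularGraph M Ψ Φ ↔
    ∃ y : H, (p.1, y) ∈ relativeTomitaGraph M Ψ Φ ∧
      (y, p.2) ∈ conjAdjointGraph (relativeTomitaGraph M Ψ Φ) :=
  Iff.rfl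

/-- `S` is single-valued because its adjoint is densely defined: the domain of `S†` contains `M' Ψ`.
-/
theorem eq_zero_of_mem_relativeTomitaGraph (h' : IsCyclicVector M.commutant Ψ) {y : H}
    (hy : ((0 : H), y) ∈ relativeTomitaGraph M Ψ Φ) : y = 0 := by
  refine h'.eq_zero_of_inner_right ℂ ?_
  rintro _ ⟨T, hT, rfl⟩
  have h1 := relativeTomitaGraph_commutant_subset M Ψ Φ (apply_mem_relativeTomitaGraph hT Ψ Φ)
  simpa using h1 _ hy

theorem eq_zero_of_mem_conjAdjointGraph (h : IsCyclicVector M Ψ) {z : H}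
    (hz : ((0 : H), z) ∈ conjAdjointGraph (relativeTomitaGraph M Ψ Φ)) : z = 0 := by
  refine h.eq_zero_of_inner_right ℂ ?_
  rintro _ ⟨O, hO, rfl⟩
  have h1 := hz _ (apply_mem_relativeTomitaGraph hO Ψ Φ)
  simpa [eq_comm] using h1

theorem relativeModularGraph_snd_eq_zero (h : IsCyclicVector M Ψ)
    (h' : IsCyclicVector M.commutant Ψ) (p : H × H) (hp : p ∈ relativeModularGraph M Ψ Φ)
    (hp0 : p.1 = 0) : p.2 = 0 := by
  obtain ⟨y, hy, hz⟩ := mem_relativeModularGraph_iff.mp hp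
  rw [hp0] at hy
  obtain rfl := eq_zero_of_mem_relativeTomitaGraph h' hy
  exact eq_zero_of_mem_conjAdjointGraph h hz

theorem graph_relativeModularOperator (h : IsCyclicVector M Ψ)
    (h' : IsCyclicVector M.commutant Ψ) :
    (relativeModularOperator M Ψ Φ).graph = relativeModularGraph M Ψ Φ :=
  Submodule.toLinearPMap_graph_eq _ (relativeModularGraph_snd_eq_zero h h')

theorem exists_inner_eq_of_mem_relativeModularGraph {p : H × H}
    (hp : p ∈ relativeModularGraph M Ψ Φ) : ∃ y : H, ⟪p.1, p.2⟫_ℂ = ((‖y‖ ^ 2 : ℝ) : ℂ) := by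
  obtain ⟨y, hy, hz⟩ := mem_relativeModularGraph_iff.mp hp
  refine ⟨y, ?_⟩
  have h1 := hz _ hy
  simp only [inner_conj_symm] at h1
  rw [← h1, inner_self_eq_norm_sq_to_K]
  norm_cast

/-- Von Neumann's argument: project `(w, 0)` onto the closed graph of `S`. For the projection `(a, S
a)`, orthogonality of `(w - a, -S a)` to the graph says `S† S a = w - a`. As `S` is conjugate-linear
its graph is only a real subspace, so the projection is taken in the underlying real Hilbert space.
-/
theorem exists_mem_relativeModularGraph_add_eq (M : VonNeumannAlgebra H) (Ψ Φ w : H) :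
    ∃ p ∈ relativeModularGraph M Ψ Φ, p.1 + p.2 = w := by
  let _ : InnerProductSpace ℝ H := InnerProductSpace.complexToReal
  have hre : ∀ a b : H, ⟪a, b⟫_ℝ = (⟪a, b⟫_ℂ).re := fun a b => rfl
  let G : Submodule ℝ (WithLp 2 (H × H)) :=
    { carrier := {p | (p.fst, p.snd) ∈ relativeTomitaGraph M Ψ Φ}
      zero_mem' := relativeTomitaGraph_zero M Ψ Φ
      add_mem' := fun h h' => relativeTomitaGraph_add h h'
      smul_mem' := fun c p hp => by
        have := relativeTomitaGraph_smul (c : ℂ) hp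
        simpa using this }
  have hG : IsClosed (G : Set (WithLp 2 (H × H))) :=
    (isClosed_relativeTomitaGraph M Ψ Φ).preimage
      ((WithLp.continuous_fst 2 H H).prodMk (WithLp.continuous_snd 2 H H))
  have : CompleteSpace G := hG.completeSpace_coe
  set k := G.starProjection (WithLp.toLp 2 (w, 0)) with hk
  have hkG : (k.fst, k.snd) ∈ relativeTomitaGraph M Ψ Φ := G.starProjection_apply_mem _
  have horth : ∀ a b : H, (a, b) ∈ relativeTomitaGraph M Ψ Φ →
      (⟪w - k.fst, a⟫_ℂ).re = (⟪k.snd, b⟫_ℂ).re := by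
    intro a b hab
    have h1 := G.starProjection_inner_eq_zero (WithLp.toLp 2 (w, 0)) (WithLp.toLp 2 (a, b)) hab
    rw [← hk, WithLp.prod_inner_apply] at h1
    simp only [hre] at h1
    simp at h1
    simp
    linarith
  refine ⟨(k.fst, w - k.fst), ⟨k.snd, hkG, ?_⟩, by simp⟩
  rintro ⟨a, b⟩ hab
  have h1 := horth a b hab
  -- Testing on `I • a` recovers the imaginary part that the real inner product does not see.
  have h2 := horth _ _ (relativeTomitaGraph_smul Complex.I hab)
  simp only [inner_smul_right, Complex.conj_I, Complex.mul_re, Complex.I_re, Complex.I_im,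
    Complex.neg_re, Complex.neg_im] at h2
  refine Complex.ext ?_ ?_
  · rw [Complex.conj_re]
    exact h1.symm
  · simp only [Complex.conj_im]
    linarith

/-- An isometry that intertwines the relative Tomita operators of two algebras, and of their
commutants, intertwines the relative modular operators. -/
theorem map_mem_relativeModularGraph {K : Type*} [NormedAddCommGroup K] [InnerProductSpace ℂ K]
    [CompleteSpace K] {N : VonNeumannAlgebra K} (u : H →ₗᵢ[ℂ] K) (h : IsCyclicVector M Ψ)
    (h' : IsCyclicVector M.commutant Ψ)
    (hu : ∀ p ∈ relativeTomitaGraph M Ψ Φ, (u p.1, u p.2) ∈ relativeTomitaGraph N (u Ψ) (u Φ))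
    (hu' : ∀ p ∈ relativeTomitaGraph M.commutant Ψ Φ,
      (u p.1, u p.2) ∈ relativeTomitaGraph N.commutant (u Ψ) (u Φ))
    {p : H × H} (hp : p ∈ relativeModularGraph M Ψ Φ) :
    (u p.1, u p.2) ∈ relativeModularGraph N (u Ψ) (u Φ) := by
  obtain ⟨y, hy, hz⟩ := mem_relativeModularGraph_iff.mp hp
  refine ⟨u y, hu _ hy, ?_⟩
  -- Directly, `u y` would have to be tested on the whole domain of the larger operator, beyond the
  -- range of `u`. Read as a limit from `M'`, the adjoint pair can be pushed forward.
  rw [conjAdjointGraph_relativeTomitaGraph h h'] at hz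
  exact relativeTomitaGraph_commutant_subset _ _ _ (hu' _ hz)

theorem map_mem_relativeTomitaGraph {K : Type*} [NormedAddCommGroup K] [InnerProductSpace ℂ K]
    [CompleteSpace K] {N : VonNeumannAlgebra K} (u : H →ₗᵢ[ℂ] K)
    (hu : ∀ O ∈ M, ∃ T ∈ N, ∀ x, u (O x) = T (u x) ∧ u (star O x) = star T (u x))
    {p : H × H} (hp : p ∈ relativeTomitaGraph M Ψ Φ) :
    (u p.1, u p.2) ∈ relativeTomitaGraph N (u Ψ) (u Φ) := by
  obtain ⟨O, hO, h1, h2⟩ := hp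
  choose T hT hTu using fun n => hu (O n) (hO n)
  refine ⟨T, hT, ?_, ?_⟩
  · simpa only [Function.comp_def, ← (hTu _ _).1] using (u.continuous.tendsto _).comp h1
  · simpa only [Function.comp_def, ← (hTu _ _).2] using (u.continuous.tendsto _).comp h2

/-- If every element of `M` and of its commutant is implemented through the isometry `u` by an
element of `N` and of its commutant, and some vector in the range of `u` is separating for `N`,
then `u` maps cyclic vectors for the commutant of `M` to separating vectors for `N`. -/
theorem isSeparatingVector_map {K : Type*} [NormedAddCommGroup K] [InnerProductSpace ℂ K]
    [CompleteSpace K] {N : VonNeumannAlgebra K} (u : H →ₗᵢ[ℂ] K)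
    (hu : ∀ O ∈ M.commutant, ∃ T ∈ N.commutant, ∀ x, u (O x) = T (u x)) {Ω : H}
    (hΩ : IsSeparatingVector N (u Ω)) (h : IsCyclicVector M.commutant Ψ) :
    IsSeparatingVector N (u Ψ) := by
  intro T hT hTΨ
  refine hΩ T hT ?_
  -- Only `T ∘ u = 0` comes out of density; off the range of `u` the conclusion `T = 0` comes from
  -- `Ω`.
  have key : (fun x => T (u x)) = fun _ => 0 := by
    refine Continuous.ext_on h (T.continuous.comp u.continuous) continuous_const ?_
    rintro _ ⟨O, hO, rfl⟩
    obtain ⟨S, hS, hSu⟩ := hu O hO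
    simp only
    rw [hSu, mul_comm_of_mem_commutant hT hS, hTΨ, map_zero]
  exact congrFun key Ω

end ModularOperator

/-! ### Calculus of projection valued measures and their reduction of the operator. -/

section SpectralMeasure

open Filter Topology MeasureTheory

namespace ProjectionValuedMeasure

variable {H : Type*} [NormedAddCommGroup H] [InnerProductSpace ℂ H] [CompleteSpace H]
  (P : ProjectionValuedMeasure H)

theorem ext_of_measurableSet {P Q : ProjectionValuedMeasure H}
    (h : ∀ s, MeasurableSet s → P.proj s = Q.proj s) : P = Q := by
  have h' : P.proj = Q.proj := by
    funext s
    by_cases hs : MeasurableSet s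
    · exact h s hs
    · rw [P.not_measurable' s hs, Q.not_measurable' s hs]
  cases P
  cases Q
  congr

theorem proj_proj {s t : Set ℝ} (hs : MeasurableSet s) (ht : MeasurableSet t) (x : H) :
    P.proj s (P.proj t x) = P.proj (s ∩ t) x :=
  congrArg (fun T : H →L[ℂ] H => T x) (P.inter' s t hs ht)

theorem proj_proj_self {s : Set ℝ} (hs : MeasurableSet s) (x : H) :
    P.proj s (P.proj s x) = P.proj s x := by
  rw [P.proj_proj hs hs, Set.inter_self]

theorem inner_proj_left {s : Set ℝ} (hs : MeasurableSet s) (x y : H) :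
    ⟪P.proj s x, y⟫_ℂ = ⟪x, P.proj s y⟫_ℂ := by
  conv_lhs => rw [← (P.isStarProjection' s hs).isSelfAdjoint.star_eq]
  exact star_inner_left _ _ _

theorem inner_proj_self {s : Set ℝ} (hs : MeasurableSet s) (x : H) :
    ⟪x, P.proj s x⟫_ℂ = ((‖P.proj s x‖ ^ 2 : ℝ) : ℂ) := by
  rw [← P.proj_proj_self hs, ← P.inner_proj_left hs, inner_self_eq_norm_sq_to_K,
    P.proj_proj_self hs]
  norm_cast

theorem scalarMeasure_apply {s : Set ℝ} (hs : MeasurableSet s) (x : H) :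
    P.scalarMeasure x s = ENNReal.ofReal (‖P.proj s x‖ ^ 2) := by
  rw [scalarMeasure, Measure.ofMeasurable_apply _ hs, P.inner_proj_self hs, Complex.ofReal_re]

theorem scalarMeasure_univ (x : H) : P.scalarMeasure x Set.univ = ENNReal.ofReal (‖x‖ ^ 2) := by
  rw [P.scalarMeasure_apply .univ, P.univ', one_apply_eq_self]

instance (x : H) : IsFiniteMeasure (P.scalarMeasure x) :=
  ⟨by rw [P.scalarMeasure_univ]; exact ENNReal.ofReal_lt_top⟩

theorem scalarMeasure_proj {s : Set ℝ} (hs : MeasurableSet s) (x : H) :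
    P.scalarMeasure (P.proj s x) = (P.scalarMeasure x).restrict s := by
  ext t ht
  rw [Measure.restrict_apply ht, P.scalarMeasure_apply ht, P.scalarMeasure_apply (ht.inter hs),
    P.proj_proj ht hs]

theorem scalarMeasure_add {s : Set ℝ} (hs : MeasurableSet s) {x y : H} (hx : P.proj s x = x)
    (hy : P.proj s y = 0) : P.scalarMeasure (x + y) = P.scalarMeasure x + P.scalarMeasure y := by
  ext t ht
  rw [Measure.add_apply, P.scalarMeasure_apply ht, P.scalarMeasure_apply ht,
    P.scalarMeasure_apply ht, ← ENNReal.ofReal_add (by positivity) (by positivity), map_add]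
  congr 1
  have h0 : ⟪P.proj t x, P.proj t y⟫_ℂ = 0 := by
    rw [P.inner_proj_left ht, P.proj_proj_self ht, ← hx, P.inner_proj_left hs, P.proj_proj hs ht,
      Set.inter_comm, ← P.proj_proj ht hs, hy, map_zero, inner_zero_right]
  have := norm_add_sq (𝕜 := ℂ) (P.proj t x) (P.proj t y)
  rw [h0] at this
  simpa using this

theorem scalarMeasure_real {s : Set ℝ} (hs : MeasurableSet s) (x : H) :
    (P.scalarMeasure x).real s = ‖P.proj s x‖ ^ 2 := by
  rw [Measure.real, P.scalarMeasure_apply hs, ENNReal.toReal_ofReal (by positivity)]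

/-- Finite additivity holds for the quadratic forms, which are measures; on a complex space these
determine the operators. -/
theorem proj_union {s t : Set ℝ} (hs : MeasurableSet s) (ht : MeasurableSet t)
    (hd : Disjoint s t) (x : H) : P.proj (s ∪ t) x = P.proj s x + P.proj t x := by
  have key : (P.proj (s ∪ t) : H →ₗ[ℂ] H) = (P.proj s + P.proj t : H →L[ℂ] H) := by
    rw [← ext_inner_map]
    intro x
    have h := measureReal_union (μ := P.scalarMeasure x) hd ht
    rw [P.scalarMeasure_real hs, P.scalarMeasure_real ht, P.scalarMeasure_real (hs.union ht)] at h
    simp only [ContinuousLinearMap.coe_coe, add_apply, inner_add_left, P.inner_proj_left hs,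
      P.inner_proj_left ht, P.inner_proj_left (hs.union ht), P.inner_proj_self hs,
      P.inner_proj_self ht, P.inner_proj_self (hs.union ht), h]
    push_cast
    rfl
  exact congrArg (fun T : H →ₗ[ℂ] H => T x) key

theorem proj_compl {s : Set ℝ} (hs : MeasurableSet s) (x : H) :
    P.proj sᶜ x = x - P.proj s x := by
  have h := P.proj_union hs hs.compl disjoint_compl_right x
  rw [Set.union_compl_self, P.univ', one_apply_eq_self] at h
  rw [eq_sub_iff_add_eq', ← h]

theorem proj_diff {s t : Set ℝ} (hs : MeasurableSet s) (ht : MeasurableSet t) (hst : s ⊆ t)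
    (x : H) : P.proj (t \ s) x = P.proj t x - P.proj s x := by
  have h := P.proj_union hs (ht.diff hs) Set.disjoint_sdiff_right x
  rw [Set.union_sdiff_cancel hst] at h
  rw [eq_sub_iff_add_eq', ← h]

theorem tendsto_proj_iUnion {s : ℕ → Set ℝ} (hs : ∀ n, MeasurableSet (s n)) (hm : Monotone s)
    (x : H) : Tendsto (fun n => P.proj (s n) x) atTop (𝓝 (P.proj (⋃ n, s n) x)) := by
  have h1 := tendsto_measure_iUnion_atTop (μ := P.scalarMeasure x) hm
  have h2 : Tendsto (fun n => (P.scalarMeasure x).real (s n)) atTop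
      (𝓝 ((P.scalarMeasure x).real (⋃ n, s n))) :=
    (ENNReal.tendsto_toReal (measure_ne_top _ _)).comp h1
  have h3 : ∀ n, ‖P.proj (s n) x - P.proj (⋃ n, s n) x‖ ^ 2 =
      (P.scalarMeasure x).real (⋃ n, s n) - (P.scalarMeasure x).real (s n) := fun n => by
    have hsub : s n ⊆ ⋃ n, s n := Set.subset_iUnion s n
    rw [← measureReal_sdiff hsub (hs n),
      P.scalarMeasure_real ((MeasurableSet.iUnion hs).diff (hs n)),
      P.proj_diff (hs n) (MeasurableSet.iUnion hs) hsub, norm_sub_rev]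
  have h4 : Tendsto (fun n => ‖P.proj (s n) x - P.proj (⋃ n, s n) x‖ ^ 2) atTop (𝓝 0) := by
    simp only [h3]
    simpa using h2.const_sub ((P.scalarMeasure x).real (⋃ n, s n))
  rw [tendsto_iff_norm_sub_tendsto_zero]
  simpa [Function.comp_def] using (Real.continuous_sqrt.tendsto 0).comp h4

theorem tendsto_proj_Icc (x : H) :
    Tendsto (fun n : ℕ => P.proj (Set.Icc (-(n : ℝ)) n) x) atTop (𝓝 x) := by
  have hm : Monotone fun n : ℕ => Set.Icc (-(n : ℝ)) n := fun m n hmn =>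
    Set.Icc_subset_Icc (by simpa using hmn) (by simpa using hmn)
  have h := P.tendsto_proj_iUnion (fun n => measurableSet_Icc) hm x
  have hU : (⋃ n : ℕ, Set.Icc (-(n : ℝ)) n) = Set.univ := by
    refine Set.eq_univ_of_forall fun t => ?_
    obtain ⟨n, hn⟩ := exists_nat_ge |t|
    exact Set.mem_iUnion.mpr ⟨n, abs_le.mp hn⟩
  rwa [hU, P.univ', one_apply_eq_self] at h

/-- A subspace of `H × H` with real quadratic form `⟪x, y⟫` is symmetric. -/
theorem _root_.Submodule.inner_fst_snd_eq {E : Type*} [NormedAddCommGroup E]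
    [InnerProductSpace ℂ E] {G : Submodule ℂ (E × E)} (hG : ∀ p ∈ G, (⟪p.1, p.2⟫_ℂ).im = 0)
    {p q : E × E} (hp : p ∈ G) (hq : q ∈ G) : ⟪p.1, q.2⟫_ℂ = ⟪p.2, q.1⟫_ℂ := by
  have h1 := hG _ (add_mem hp hq)
  have h2 := hG _ (add_mem hp (G.smul_mem Complex.I hq))
  have h3 := hG _ hp
  have h4 := hG _ hq
  simp only [Prod.fst_add, Prod.snd_add, Prod.smul_fst, Prod.smul_snd, inner_add_left,
    inner_add_right, inner_smul_left, inner_smul_right, Complex.add_im, Complex.mul_im,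
    Complex.add_re, Complex.mul_re, Complex.I_re, Complex.I_im, Complex.conj_I, Complex.neg_re, Complex.neg_im,
    h3, h4] at h1 h2
  rw [← inner_conj_symm p.2 q.1]
  refine Complex.ext ?_ ?_
  · rw [Complex.conj_re]
    linarith
  · rw [Complex.conj_im]
    linarith

namespace IsSpectralMeasureOf

variable {P} {A : H →ₗ.[ℂ] H}

theorem inner_eq_integral (hA : P.IsSpectralMeasureOf A) {p : H × H} (hp : p ∈ A.graph) :
    ⟪p.1, p.2⟫_ℂ = ((∫ t, t ∂(P.scalarMeasure p.1) : ℝ) : ℂ) := by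
  obtain ⟨x, hx, hy⟩ := A.mem_graph_iff.mp hp
  rw [← hx, ← hy]
  exact hA.2 x

theorem inner_symm (hA : P.IsSpectralMeasureOf A) {p q : H × H} (hp : p ∈ A.graph)
    (hq : q ∈ A.graph) : ⟪p.1, q.2⟫_ℂ = ⟪p.2, q.1⟫_ℂ :=
  Submodule.inner_fst_snd_eq (G := A.graph)
    (fun p hp => by rw [hA.inner_eq_integral hp, Complex.ofReal_im]) hp hq

theorem lintegral_lt_top (hA : P.IsSpectralMeasureOf A) {p : H × H} (hp : p ∈ A.graph) :
    ∫⁻ t, ENNReal.ofReal (t ^ 2) ∂(P.scalarMeasure p.1) < ∞ := by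
  obtain ⟨x, hx, -⟩ := A.mem_graph_iff.mp hp
  rw [← hx]
  exact (hA.1 x).mp x.2

theorem exists_mem_graph (hA : P.IsSpectralMeasureOf A) {x : H}
    (hx : ∫⁻ t, ENNReal.ofReal (t ^ 2) ∂(P.scalarMeasure x) < ∞) : ∃ y, (x, y) ∈ A.graph :=
  ⟨A ⟨x, (hA.1 x).mpr hx⟩, A.mem_graph ⟨x, (hA.1 x).mpr hx⟩⟩

theorem integrable (hA : P.IsSpectralMeasureOf A) {p : H × H} (hp : p ∈ A.graph) :
    Integrable (fun t : ℝ => t) (P.scalarMeasure p.1) := by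
  refine ⟨measurable_id.aestronglyMeasurable, ?_⟩
  calc ∫⁻ t, ‖t‖ₑ ∂(P.scalarMeasure p.1)
      ≤ ∫⁻ t, (1 + ENNReal.ofReal (t ^ 2)) ∂(P.scalarMeasure p.1) := by
        refine lintegral_mono fun t => ?_
        simp only
        rw [← ofReal_norm, ← ENNReal.ofReal_one,
          ← ENNReal.ofReal_add zero_le_one (by positivity)]
        refine ENNReal.ofReal_le_ofReal ?_
        rw [Real.norm_eq_abs, ← sq_abs]
        nlinarith [sq_nonneg (|t| - 1)]
    _ < ∞ := by
        rw [lintegral_add_left measurable_const, lintegral_const, one_mul]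
        exact ENNReal.add_lt_top.mpr ⟨measure_lt_top _ _, hA.lintegral_lt_top hp⟩

theorem exists_mem_graph_proj (hA : P.IsSpectralMeasureOf A) {p : H × H} (hp : p ∈ A.graph)
    {s : Set ℝ} (hs : MeasurableSet s) : ∃ y, (P.proj s p.1, y) ∈ A.graph := by
  refine hA.exists_mem_graph ?_
  rw [P.scalarMeasure_proj hs]
  exact (lintegral_mono' Measure.restrict_le_self le_rfl).trans_lt (hA.lintegral_lt_top hp)

theorem exists_mem_graph_of_bounded (hA : P.IsSpectralMeasureOf A) {a b : ℝ} (x : H) :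
    ∃ y, (P.proj (Set.Icc a b) x, y) ∈ A.graph := by
  refine hA.exists_mem_graph ?_
  rw [P.scalarMeasure_proj measurableSet_Icc]
  calc ∫⁻ t in Set.Icc a b, ENNReal.ofReal (t ^ 2) ∂(P.scalarMeasure x)
      ≤ ∫⁻ _ in Set.Icc a b, ENNReal.ofReal (a ^ 2 + b ^ 2) ∂(P.scalarMeasure x) := by
        refine setLIntegral_mono measurable_const fun t ht => ENNReal.ofReal_le_ofReal ?_
        rcases le_total 0 t with h | h
        · nlinarith [ht.1, ht.2, sq_nonneg a]
        · nlinarith [ht.1, ht.2, sq_nonneg b]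
    _ < ∞ := by
        rw [lintegral_const]
        exact ENNReal.mul_lt_top ENNReal.ofReal_lt_top (measure_lt_top _ _)

theorem dense_domain (hA : P.IsSpectralMeasureOf A) : Dense {x : H | ∃ y, (x, y) ∈ A.graph} :=
  fun x => mem_closure_of_tendsto (P.tendsto_proj_Icc x)
    (Eventually.of_forall fun _ => hA.exists_mem_graph_of_bounded x)

/-- The scalar measure of `p.1 + q.1` is the sum of the two, so the cross terms of the quadratic
form cancel; replacing `q` by `I • q` separates them. -/
theorem inner_eq_zero (hA : P.IsSpectralMeasureOf A) {p q : H × H} (hp : p ∈ A.graph)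
    (hq : q ∈ A.graph) {s : Set ℝ} (hs : MeasurableSet s) (hps : P.proj s p.1 = p.1)
    (hqs : P.proj s q.1 = 0) : ⟪q.1, p.2⟫_ℂ = 0 := by
  have key : ∀ q ∈ A.graph, P.proj s q.1 = 0 → ⟪p.1, q.2⟫_ℂ + ⟪q.1, p.2⟫_ℂ = 0 := by
    intro q hq hqs
    have h1 := hA.inner_eq_integral (add_mem hp hq)
    rw [Prod.fst_add, P.scalarMeasure_add hs hps hqs,
      integral_add_measure (hA.integrable hp) (hA.integrable hq), Complex.ofReal_add,
      ← hA.inner_eq_integral hp, ← hA.inner_eq_integral hq, Prod.snd_add, inner_add_left,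
      inner_add_right, inner_add_right] at h1
    linear_combination h1
  have h1 := key q hq hqs
  have h2 := key (Complex.I • q) (A.graph.smul_mem _ hq) (by simp [hqs])
  simp only [Prod.smul_fst, Prod.smul_snd, inner_smul_left, inner_smul_right,
    Complex.conj_I] at h2
  have h3 : Complex.I * (2 * ⟪q.1, p.2⟫_ℂ) = 0 := by linear_combination Complex.I * h1 - h2
  simpa using h3

/-- `A` maps the part of its domain in the range of `P s` into that range, since the image is
orthogonal to the complementary part of the dense domain. Applied to `s` and `sᶜ`, this says that `P
s` commutes with `A`. -/
theorem proj_mem_graph (hA : P.IsSpectralMeasureOf A) {p : H × H} (hp : p ∈ A.graph)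
    {s : Set ℝ} (hs : MeasurableSet s) : (P.proj s p.1, P.proj s p.2) ∈ A.graph := by
  have key : ∀ s, MeasurableSet s → ∀ y, (P.proj s p.1, y) ∈ A.graph → P.proj s y = y := by
    intro s hs y hy
    have h0 : y - P.proj s y = 0 := by
      refine hA.dense_domain.eq_zero_of_inner_right ℂ ?_
      rintro v ⟨w, hw⟩
      obtain ⟨z, hz⟩ := hA.exists_mem_graph_proj hw hs.compl
      rw [← P.proj_compl hs, ← P.inner_proj_left hs.compl]
      refine hA.inner_eq_zero hy hz hs (P.proj_proj_self hs _) ?_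
      simp only
      rw [P.proj_proj hs hs.compl, Set.inter_compl_self, P.empty']
      rfl
    exact (sub_eq_zero.mp h0).symm
  obtain ⟨y, hy⟩ := hA.exists_mem_graph_proj hp hs
  have hy' : (P.proj sᶜ p.1, p.2 - y) ∈ A.graph := by
    rw [P.proj_compl hs]
    exact sub_mem hp hy
  have h1 := key s hs y hy
  have h2 := key _ hs.compl _ hy'
  rw [P.proj_compl hs, sub_eq_self, map_sub, h1, sub_eq_zero] at h2
  rwa [h2]

theorem le_re_inner (hA : P.IsSpectralMeasureOf A) {p : H × H} (hp : p ∈ A.graph) {a b : ℝ}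
    (hps : P.proj (Set.Icc a b) p.1 = p.1) : a * ‖p.1‖ ^ 2 ≤ (⟪p.1, p.2⟫_ℂ).re := by
  rw [hA.inner_eq_integral hp, Complex.ofReal_re]
  have h1 := hA.integrable hp
  have h2 := P.scalarMeasure_real MeasurableSet.univ p.1
  rw [P.univ', one_apply_eq_self] at h2
  have h3 : ∫ _, a ∂(P.scalarMeasure p.1) = a * ‖p.1‖ ^ 2 := by
    rw [integral_const, h2, smul_eq_mul, mul_comm]
  rw [← h3]
  refine integral_mono_ae (integrable_const a) h1 ?_
  rw [← hps, P.scalarMeasure_proj measurableSet_Icc]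
  exact (ae_restrict_iff' measurableSet_Icc).mpr (Eventually.of_forall fun t ht => ht.1)

theorem re_inner_le (hA : P.IsSpectralMeasureOf A) {p : H × H} (hp : p ∈ A.graph) {a b : ℝ}
    (hps : P.proj (Set.Icc a b) p.1 = p.1) : (⟪p.1, p.2⟫_ℂ).re ≤ b * ‖p.1‖ ^ 2 := by
  rw [hA.inner_eq_integral hp, Complex.ofReal_re]
  have h1 := hA.integrable hp
  have h2 := P.scalarMeasure_real MeasurableSet.univ p.1
  rw [P.univ', one_apply_eq_self] at h2
  have h3 : ∫ _, b ∂(P.scalarMeasure p.1) = b * ‖p.1‖ ^ 2 := by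
    rw [integral_const, h2, smul_eq_mul, mul_comm]
  rw [← h3]
  refine integral_mono_ae h1 (integrable_const b) ?_
  rw [← hps, P.scalarMeasure_proj measurableSet_Icc]
  exact (ae_restrict_iff' measurableSet_Icc).mpr (Eventually.of_forall fun t ht => ht.2)

end IsSpectralMeasureOf

end ProjectionValuedMeasure

end SpectralMeasure

/-! ### Bounded intertwiners of operators intertwine their spectral measures. -/

section Intertwining

open Filter Topology MeasureTheory

/-- If `y = B x` and `z = B y` for a symmetric `B` with `0 ≤ B ≤ h`, then `‖y‖ ≤ h ‖x‖`. -/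
theorem norm_le_of_form_bounds {E : Type*} [NormedAddCommGroup E] [InnerProductSpace ℂ E]
    {x y z : E} {h : ℝ} (hh : 0 < h) (hsymm : ⟪x, z⟫_ℂ = ⟪y, y⟫_ℂ)
    (hnonneg : 0 ≤ (⟪(h : ℂ) • x - y, (h : ℂ) • y - z⟫_ℂ).re)
    (hx : (⟪x, y⟫_ℂ).re ≤ h * ‖x‖ ^ 2) (hy : (⟪y, z⟫_ℂ).re ≤ h * ‖y‖ ^ 2) :
    ‖y‖ ≤ h * ‖x‖ := by
  have hyy : (⟪y, y⟫_ℂ).re = ‖y‖ ^ 2 := inner_self_eq_norm_sq (𝕜 := ℂ) y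
  -- `hnonneg` is positivity of `B` at `(h - B) x`. Expanded, with `hy` bounding `⟪y, z⟫`, it gives
  -- `‖y‖ ^ 2 ≤ h ⟪x, B x⟫`.
  simp only [inner_sub_left, inner_sub_right, inner_smul_left, inner_smul_right, hsymm,
    Complex.conj_ofReal, Complex.sub_re, Complex.re_ofReal_mul, hyy] at hnonneg
  have h1 : ‖y‖ ^ 2 ≤ h * (⟪x, y⟫_ℂ).re := by nlinarith
  refine abs_le_of_sq_le_sq' ?_ (by positivity) |>.2
  rw [mul_pow]
  nlinarith

namespace ProjectionValuedMeasure

variable {H : Type*} [NormedAddCommGroup H] [InnerProductSpace ℂ H] [CompleteSpace H]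
  (P : ProjectionValuedMeasure H)

theorem norm_proj_apply_le {s : Set ℝ} (hs : MeasurableSet s) (x : H) : ‖P.proj s x‖ ≤ ‖x‖ := by
  have h := (P.proj s).le_of_opNorm_le ((P.isStarProjection' s hs).norm_le _) x
  rwa [one_mul] at h

/-- The shift by `1` keeps every interval nondegenerate, as the bounds on spectral subspaces
require. -/
theorem tendsto_proj_Iic (c : ℝ) (x : H) :
    Tendsto (fun n : ℕ => P.proj (Set.Icc (c - 1 - n) c) x) atTop (𝓝 (P.proj (Set.Iic c) x)) := by
  have hm : Monotone fun n : ℕ => Set.Icc (c - 1 - n) c := fun m n hmn =>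
    Set.Icc_subset_Icc (by gcongr) le_rfl
  have h := P.tendsto_proj_iUnion (fun n => measurableSet_Icc) hm x
  have hU : (⋃ n : ℕ, Set.Icc (c - 1 - n) c) = Set.Iic c := by
    ext t
    simp only [Set.mem_iUnion, Set.mem_Icc, Set.mem_Iic]
    refine ⟨fun ⟨n, hn⟩ => hn.2, fun ht => ?_⟩
    obtain ⟨n, hn⟩ := exists_nat_ge (c - 1 - t)
    exact ⟨n, by linarith, ht⟩
  rwa [hU] at h

theorem tendsto_proj_Ioi (c : ℝ) (x : H) :
    Tendsto (fun n : ℕ => P.proj (Set.Icc (c + 1 / ((n : ℝ) + 1)) (c + 2 + n)) x) atTop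
      (𝓝 (P.proj (Set.Ioi c) x)) := by
  have hm : Monotone fun n : ℕ => Set.Icc (c + 1 / ((n : ℝ) + 1)) (c + 2 + n) := fun m n hmn =>
    Set.Icc_subset_Icc (by gcongr) (by gcongr)
  have h := P.tendsto_proj_iUnion (fun n => measurableSet_Icc) hm x
  have hU : (⋃ n : ℕ, Set.Icc (c + 1 / ((n : ℝ) + 1)) (c + 2 + n)) = Set.Ioi c := by
    ext t
    simp only [Set.mem_iUnion, Set.mem_Icc, Set.mem_Ioi]
    refine ⟨fun ⟨n, hn⟩ => lt_of_lt_of_le ?_ hn.1, fun ht => ?_⟩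
    · have : 0 < 1 / ((n : ℝ) + 1) := by positivity
      linarith
    · obtain ⟨n, hn⟩ := exists_nat_one_div_lt (sub_pos.mpr ht)
      obtain ⟨k, hk⟩ := exists_nat_ge (t - c - 2)
      refine ⟨max n k, ?_, ?_⟩
      · have : 1 / (((max n k : ℕ) : ℝ) + 1) ≤ 1 / ((n : ℝ) + 1) := by
          gcongr
          exact le_max_left _ _
        linarith
      · have : (k : ℝ) ≤ (max n k : ℕ) := by exact_mod_cast le_max_right _ _
        linarith
  rwa [hU] at h

namespace IsSpectralMeasureOf

variable {H K : Type*} [NormedAddCommGroup H] [InnerProductSpace ℂ H] [CompleteSpace H]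
  [NormedAddCommGroup K] [InnerProductSpace ℂ K] [CompleteSpace K]
  {P : ProjectionValuedMeasure H} {A : H →ₗ.[ℂ] H}
  {Q : ProjectionValuedMeasure K} {B : K →ₗ.[ℂ] K}

/-- The form bounds are turned into a norm bound by applying `norm_le_of_form_bounds` to `σ (A - m)`
on a spectral subspace. Here `r.1` is `(h - σ (A - m)) p.1`. The sign `σ` covers both endpoints of
the interval. -/
theorem norm_sub_smul_le (hA : P.IsSpectralMeasureOf A) {a b m h σ : ℝ} (hh : 0 < h)
    (hσ : σ * σ = 1)
    (hform : ∀ q ∈ A.graph, P.proj (Set.Icc a b) q.1 = q.1 →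
      0 ≤ σ * ((⟪q.1, q.2⟫_ℂ).re - m * ‖q.1‖ ^ 2) ∧
        σ * ((⟪q.1, q.2⟫_ℂ).re - m * ‖q.1‖ ^ 2) ≤ h * ‖q.1‖ ^ 2)
    {p : H × H} (hp : p ∈ A.graph) (hps : P.proj (Set.Icc a b) p.1 = p.1) :
    ‖p.2 - (m : ℂ) • p.1‖ ≤ h * ‖p.1‖ := by
  have hself : ∀ v : H, (⟪v, v⟫_ℂ).re = ‖v‖ ^ 2 := fun v => inner_self_eq_norm_sq (𝕜 := ℂ) v
  have hp2 : P.proj (Set.Icc a b) p.2 = p.2 := by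
    have h := hA.proj_mem_graph hp (measurableSet_Icc (a := a) (b := b))
    rw [hps] at h
    exact A.mem_graph_snd_inj h hp rfl
  have hσ' : (σ : ℂ) * σ = 1 := by exact_mod_cast hσ
  obtain ⟨w, hw⟩ := hA.exists_mem_graph_of_bounded (a := a) (b := b) p.2
  rw [hp2] at hw
  set q : H × H := (p.2, w) - (m : ℂ) • p with hq
  have hqm : q ∈ A.graph := sub_mem hw (A.graph.smul_mem _ hp)
  have hq1 : q.1 = p.2 - (m : ℂ) • p.1 := rfl
  have hqs : P.proj (Set.Icc a b) q.1 = q.1 := by rw [hq1, map_sub, map_smul, hps, hp2]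
  set r : H × H := (h : ℂ) • p - (σ : ℂ) • q with hr
  have hrm : r ∈ A.graph := sub_mem (A.graph.smul_mem _ hp) (A.graph.smul_mem _ hqm)
  have hr1 : r.1 = (h : ℂ) • p.1 - (σ : ℂ) • q.1 := rfl
  have hr2 : r.2 = (h : ℂ) • p.2 - (σ : ℂ) • q.2 := rfl
  have hrs : P.proj (Set.Icc a b) r.1 = r.1 := by
    rw [hr1, map_sub, map_smul, map_smul, hps, hqs]
  have hσn : ‖(σ : ℂ) • q.1‖ = ‖q.1‖ := by
    rw [norm_smul, Complex.norm_real, Real.norm_eq_abs]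
    rcases mul_self_eq_one_iff.mp hσ with h | h <;> simp [h]
  have key := norm_le_of_form_bounds (x := p.1) (y := (σ : ℂ) • q.1) (z := q.2 - (m : ℂ) • q.1)
    hh ?_ ?_ ?_ ?_
  · rwa [hσn, hq1] at key
  · rw [inner_sub_right, hA.inner_symm hp hqm, inner_smul_right, inner_smul_left,
      inner_smul_right, Complex.conj_ofReal, ← mul_assoc, hσ', one_mul]
    nth_rw 3 [hq1]
    rw [inner_sub_left, inner_smul_left, Complex.conj_ofReal]
  · have e : (h : ℂ) • (σ : ℂ) • q.1 - (q.2 - (m : ℂ) • q.1) =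
        (σ : ℂ) • (r.2 - (m : ℂ) • r.1) := by
      rw [hr1, hr2]
      nth_rw 1 [hq1]
      simp only [smul_sub, smul_smul]
      rw [hσ', one_smul, mul_comm (σ : ℂ) (m * σ), mul_assoc, hσ', mul_one, mul_comm (h : ℂ) σ,
        show (h : ℂ) * (σ * m) = σ * (m * h) by ring]
      abel
    rw [e, ← hr1, inner_smul_right, inner_sub_right, inner_smul_right, Complex.re_ofReal_mul,
      Complex.sub_re, Complex.re_ofReal_mul, hself]
    exact (hform r hrm hrs).1
  · have := (hform p hp hps).2
    rw [inner_smul_right, hq1, inner_sub_right, inner_smul_right, Complex.re_ofReal_mul,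
      Complex.sub_re, Complex.re_ofReal_mul, hself]
    exact this
  · have := (hform q hqm hqs).2
    rw [hσn, inner_smul_left, Complex.conj_ofReal, inner_sub_right, inner_smul_right,
      Complex.re_ofReal_mul, Complex.sub_re, Complex.re_ofReal_mul, hself]
    exact this

theorem norm_sub_left_le (hA : P.IsSpectralMeasureOf A) {p : H × H} (hp : p ∈ A.graph) {a b : ℝ}
    (hab : a < b) (hps : P.proj (Set.Icc a b) p.1 = p.1) :
    ‖p.2 - (a : ℂ) • p.1‖ ≤ (b - a) * ‖p.1‖ := by
  refine hA.norm_sub_smul_le (σ := 1) (sub_pos.mpr hab) (by norm_num) (fun q hq hqs => ?_) hp hps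
  have h1 := hA.le_re_inner hq hqs
  have h2 := hA.re_inner_le hq hqs
  constructor <;> linarith

theorem norm_sub_right_le (hA : P.IsSpectralMeasureOf A) {p : H × H} (hp : p ∈ A.graph) {a b : ℝ}
    (hab : a < b) (hps : P.proj (Set.Icc a b) p.1 = p.1) :
    ‖p.2 - (b : ℂ) • p.1‖ ≤ (b - a) * ‖p.1‖ := by
  refine hA.norm_sub_smul_le (σ := -1) (sub_pos.mpr hab) (by norm_num) (fun q hq hqs => ?_) hp hps
  have h1 := hA.le_re_inner hq hqs
  have h2 := hA.re_inner_le hq hqs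
  constructor <;> linarith

theorem le_norm_sub_smul (hA : P.IsSpectralMeasureOf A) {p : H × H} (hp : p ∈ A.graph)
    {a b m : ℝ} (hps : P.proj (Set.Icc a b) p.1 = p.1) :
    max (a - m) (m - b) * ‖p.1‖ ≤ ‖p.2 - (m : ℂ) • p.1‖ := by
  have hself : (⟪p.1, p.1⟫_ℂ).re = ‖p.1‖ ^ 2 := inner_self_eq_norm_sq (𝕜 := ℂ) p.1
  have h1 := hA.le_re_inner hp hps
  have h2 := hA.re_inner_le hp hps
  have h3 : |(⟪p.1, p.2 - (m : ℂ) • p.1⟫_ℂ).re| ≤ ‖p.1‖ * ‖p.2 - (m : ℂ) • p.1‖ :=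
    (Complex.abs_re_le_norm _).trans (norm_inner_le_norm _ _)
  rw [inner_sub_right, inner_smul_right, Complex.sub_re, Complex.re_ofReal_mul, hself,
    abs_le] at h3
  rcases (norm_nonneg p.1).eq_or_lt with h0 | h0
  · rw [← h0, mul_zero]
    exact norm_nonneg _
  · refine le_of_mul_le_mul_left ?_ h0
    rcases max_cases (a - m) (m - b) with ⟨h, -⟩ | ⟨h, -⟩ <;> rw [h] <;> nlinarith

variable (T : H →L[ℂ] K)

/-- With `R = Q T P`, one has `(B - m) R = R (A - m)`. On the range of `P` the operator `A - m` has
norm at most `b - a`, while `B - m` expands by a factor `k > b - a` on the range of `Q`. So `‖R‖ ≤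
((b - a) / k) ‖R‖`, which forces `R = 0`. -/
theorem proj_comp_comp_proj_eq_zero (hA : P.IsSpectralMeasureOf A) (hB : Q.IsSpectralMeasureOf B)
    (hT : ∀ p ∈ A.graph, (T p.1, T p.2) ∈ B.graph) {a b c d : ℝ} (hab : a < b)
    (h : b < c ∨ d < a) (x : H) :
    Q.proj (Set.Icc c d) (T (P.proj (Set.Icc a b) x)) = 0 := by
  set R : H →L[ℂ] K := Q.proj (Set.Icc c d) ∘L T ∘L P.proj (Set.Icc a b) with hR
  -- The centre `m` is the endpoint of `[a, b]` farther from `[c, d]`.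
  obtain ⟨m, k, hk, hle, hge⟩ : ∃ m k : ℝ, b - a < k ∧
      (∀ p ∈ A.graph, P.proj (Set.Icc a b) p.1 = p.1 →
        ‖p.2 - (m : ℂ) • p.1‖ ≤ (b - a) * ‖p.1‖) ∧
      (∀ p ∈ B.graph, Q.proj (Set.Icc c d) p.1 = p.1 →
        k * ‖p.1‖ ≤ ‖p.2 - (m : ℂ) • p.1‖) := by
    rcases h with h | h
    · refine ⟨a, c - a, by linarith, fun p hp hps => hA.norm_sub_left_le hp hab hps,
        fun p hp hps => le_trans ?_ (hB.le_norm_sub_smul hp hps)⟩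
      gcongr
      exact le_max_left _ _
    · refine ⟨b, b - d, by linarith, fun p hp hps => hA.norm_sub_right_le hp hab hps,
        fun p hp hps => le_trans ?_ (hB.le_norm_sub_smul hp hps)⟩
      gcongr
      exact le_max_right _ _
  have hkpos : 0 < k := by linarith
  have hbound : ‖R‖ ≤ (b - a) / k * ‖R‖ := by
    refine R.opNorm_le_bound (by have := sub_pos.mpr hab; positivity) fun z => ?_
    obtain ⟨w, hw⟩ := hA.exists_mem_graph_of_bounded (a := a) (b := b) z
    have hw2 : P.proj (Set.Icc a b) w = w := by
      have h := hA.proj_mem_graph hw (measurableSet_Icc (a := a) (b := b))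
      simp only at h
      rw [P.proj_proj_self measurableSet_Icc] at h
      exact A.mem_graph_snd_inj h hw rfl
    have h1 := hle _ hw (P.proj_proj_self measurableSet_Icc z)
    have hg := hB.proj_mem_graph (hT _ hw) (measurableSet_Icc (a := c) (b := d))
    have h2 := hge _ hg (Q.proj_proj_self measurableSet_Icc _)
    simp only at h1 h2
    have h3 : Q.proj (Set.Icc c d) (T w) -
        (m : ℂ) • Q.proj (Set.Icc c d) (T (P.proj (Set.Icc a b) z)) =
        R (w - (m : ℂ) • P.proj (Set.Icc a b) z) := by
      simp only [hR, ContinuousLinearMap.comp_apply, map_sub, map_smul,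
        P.proj_proj_self measurableSet_Icc, hw2]
    rw [h3] at h2
    have h4 : ‖P.proj (Set.Icc a b) z‖ ≤ ‖z‖ :=
      P.norm_proj_apply_le measurableSet_Icc z
    have h5 : k * ‖R z‖ ≤ ‖R‖ * ((b - a) * ‖z‖) := by
      refine h2.trans ((R.le_opNorm _).trans ?_)
      gcongr
      exact h1.trans (by have := sub_pos.mpr hab; gcongr)
    rw [div_mul_eq_mul_div, div_mul_eq_mul_div, le_div_iff₀ hkpos]
    linarith
  have hlt : (b - a) / k < 1 := (div_lt_one hkpos).mpr hk
  have hR0 : ‖R‖ = 0 := by nlinarith [norm_nonneg R]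
  exact congrArg (fun S : H →L[ℂ] K => S x) (norm_eq_zero.mp hR0)

theorem proj_Ioi_comp_comp_proj_Iic_eq_zero (hA : P.IsSpectralMeasureOf A)
    (hB : Q.IsSpectralMeasureOf B) (hT : ∀ p ∈ A.graph, (T p.1, T p.2) ∈ B.graph) (c : ℝ) (x : H) :
    Q.proj (Set.Ioi c) (T (P.proj (Set.Iic c) x)) = 0 := by
  have h1 : ∀ n : ℕ, Q.proj (Set.Icc (c + 1 / ((n : ℝ) + 1)) (c + 2 + n))
      (T (P.proj (Set.Iic c) x)) = 0 := fun n => by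
    have h2 := ((Q.proj (Set.Icc (c + 1 / ((n : ℝ) + 1)) (c + 2 + n)) ∘L T).continuous.tendsto
      _).comp (P.tendsto_proj_Iic c x)
    refine tendsto_nhds_unique (h2.congr fun k => ?_) tendsto_const_nhds
    exact hA.proj_comp_comp_proj_eq_zero T hB hT (by linarith [k.cast_nonneg (α := ℝ)])
      (Or.inl (by have : 0 < 1 / ((n : ℝ) + 1) := by positivity
                  linarith)) x
  exact tendsto_nhds_unique (Q.tendsto_proj_Ioi c _)
    (tendsto_const_nhds.congr fun n => (h1 n).symm)

theorem proj_Iic_comp_comp_proj_Ioi_eq_zero (hA : P.IsSpectralMeasureOf A)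
    (hB : Q.IsSpectralMeasureOf B) (hT : ∀ p ∈ A.graph, (T p.1, T p.2) ∈ B.graph) (c : ℝ) (x : H) :
    Q.proj (Set.Iic c) (T (P.proj (Set.Ioi c) x)) = 0 := by
  have h1 : ∀ n : ℕ, Q.proj (Set.Icc (c - 1 - n) c) (T (P.proj (Set.Ioi c) x)) = 0 := fun n => by
    have h2 := ((Q.proj (Set.Icc (c - 1 - n) c) ∘L T).continuous.tendsto _).comp
      (P.tendsto_proj_Ioi c x)
    refine tendsto_nhds_unique (h2.congr fun k => ?_) tendsto_const_nhds
    have hk : 0 < 1 / ((k : ℝ) + 1) := by positivity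
    have hk' : 1 / ((k : ℝ) + 1) ≤ 1 := by
      rw [div_le_one (by positivity)]
      linarith [k.cast_nonneg (α := ℝ)]
    exact hA.proj_comp_comp_proj_eq_zero T hB hT (by linarith [k.cast_nonneg (α := ℝ)])
      (Or.inr (by linarith)) x
  exact tendsto_nhds_unique (Q.tendsto_proj_Iic c _)
    (tendsto_const_nhds.congr fun n => (h1 n).symm)

/-- A bounded operator that intertwines two operators intertwines their spectral measures. -/
theorem proj_apply_map (hA : P.IsSpectralMeasureOf A) (hB : Q.IsSpectralMeasureOf B)
    (hT : ∀ p ∈ A.graph, (T p.1, T p.2) ∈ B.graph) {s : Set ℝ} (hs : MeasurableSet s) (x : H) :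
    Q.proj s (T x) = T (P.proj s x) := by
  -- For a half-line both off-diagonal blocks of `T` vanish; the sets on which the projections are
  -- intertwined are then closed under complements and disjoint unions.
  induction s, hs using MeasurableSpace.induction_on_inter (borel_eq_generateFrom_Iic ℝ)
    isPiSystem_Iic with
  | empty => simp [P.empty', Q.empty']
  | basic t ht =>
    obtain ⟨c, rfl⟩ := ht
    have h1 := proj_Iic_comp_comp_proj_Ioi_eq_zero T hA hB hT c x
    have h2 := proj_Ioi_comp_comp_proj_Iic_eq_zero T hA hB hT c x
    rw [← Set.compl_Iic, P.proj_compl measurableSet_Iic, map_sub, map_sub, sub_eq_zero] at h1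
    rw [← Set.compl_Iic, Q.proj_compl measurableSet_Iic, sub_eq_zero] at h2
    rw [h1, ← h2]
  | compl t ht ih => rw [Q.proj_compl ht, P.proj_compl ht, ih, map_sub]
  | iUnion f hd hf ih =>
    have hd' : ∀ m n, m ≠ n → f m ∩ f n = ∅ := fun m n hmn =>
      Set.disjoint_iff_inter_eq_empty.mp (hd hmn)
    refine tendsto_nhds_unique (Q.iUnion' f hf hd' (T x)) ?_
    simp only [ih, ← map_sum]
    exact (T.continuous.tendsto _).comp (P.iUnion' f hf hd' x)

theorem eq_of_isSpectralMeasureOf {P' : ProjectionValuedMeasure H} (hA : P.IsSpectralMeasureOf A)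
    (hA' : P'.IsSpectralMeasureOf A) : P' = P :=
  ext_of_measurableSet fun _ hs => ContinuousLinearMap.ext fun x =>
    proj_apply_map (ContinuousLinearMap.id ℂ H) hA hA' (fun _ hp => hp) hs x

theorem scalarMeasure_map (hA : P.IsSpectralMeasureOf A) (hB : Q.IsSpectralMeasureOf B)
    (u : H →ₗᵢ[ℂ] K) (hu : ∀ p ∈ A.graph, (u p.1, u p.2) ∈ B.graph) (x : H) :
    Q.scalarMeasure (u x) = P.scalarMeasure x := by
  ext s hs
  have h := proj_apply_map u.toContinuousLinearMap hA hB hu hs x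
  simp only [LinearIsometry.coe_toContinuousLinearMap] at h
  rw [P.scalarMeasure_apply hs, Q.scalarMeasure_apply hs, h, u.norm_map]

end IsSpectralMeasureOf

end ProjectionValuedMeasure

end Intertwining

/-! ### Scalar spectral measures of a bounded self-adjoint operator. -/

section ScalarSpectralMeasure

open Filter Topology MeasureTheory

open scoped CompactlySupported

variable {H : Type*} [NormedAddCommGroup H] [InnerProductSpace ℂ H] [CompleteSpace H]
  {B : H →L[ℂ] H}

/-- The scalar spectral measures of a bounded self-adjoint operator. -/
theorem exists_scalarSpectralMeasure (hB : IsSelfAdjoint B) (x : H) :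
    ∃ μ : Measure ℝ, IsFiniteMeasure μ ∧ (∀ᵐ t ∂μ, t ∈ spectrum ℝ B) ∧
      ∀ f : ℝ → ℝ, Continuous f → ∫ t, f t ∂μ = (⟪x, cfc f B x⟫_ℂ).re := by
  -- Riesz–Markov applied to `f ↦ ⟪x, f(B) x⟫`; the spectrum is compact, so every continuous
  -- function on it has compact support.
  let Λ : C_c(spectrum ℝ B, ℝ) →ₚ[ℝ] ℝ := PositiveLinearMap.mk₀
    { toFun := fun f => (⟪x, cfcHom hB f.toContinuousMap x⟫_ℂ).re
      map_add' := fun f g => by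
        have : (f + g).toContinuousMap = f.toContinuousMap + g.toContinuousMap := rfl
        rw [this, map_add, add_apply, inner_add_right, Complex.add_re]
      map_smul' := fun c f => by
        have : (c • f).toContinuousMap = c • f.toContinuousMap := rfl
        rw [this, map_smul, smul_apply, ← Complex.coe_smul, inner_smul_right,
          Complex.re_ofReal_mul]
        rfl }
    (fun f hf => by
      have h1 : 0 ≤ cfcHom hB f.toContinuousMap := (cfcHom_nonneg_iff hB).mpr hf
      exact ((ContinuousLinearMap.nonneg_iff_isPositive _).mp h1).re_inner_nonneg_right x)
  refine ⟨(RealRMK.rieszMeasure Λ).map Subtype.val, inferInstance, ?_, fun f hf => ?_⟩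
  · refine (ae_map_iff (p := fun t => t ∈ spectrum ℝ B) measurable_subtype_coe.aemeasurable
      (spectrum.isClosed B).measurableSet).mpr ?_
    exact Eventually.of_forall fun t => t.2
  · rw [integral_map measurable_subtype_coe.aemeasurable hf.aestronglyMeasurable,
      cfc_apply f B hB hf.continuousOn]
    exact RealRMK.integral_rieszMeasure Λ
      ⟨⟨fun t : spectrum ℝ B => f t, by fun_prop⟩, HasCompactSupport.of_compactSpace _⟩

/-- The scalar spectral measure of the bounded self-adjoint operator `B` at the vector `x`. -/
noncomputable def scalarSpectralMeasure (hB : IsSelfAdjoint B) (x : H) : Measure ℝ :=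
  (exists_scalarSpectralMeasure hB x).choose

variable (hB : IsSelfAdjoint B)

instance (x : H) : IsFiniteMeasure (scalarSpectralMeasure hB x) :=
  (exists_scalarSpectralMeasure hB x).choose_spec.1

theorem integral_scalarSpectralMeasure {f : ℝ → ℝ} (hf : Continuous f) (x : H) :
    ∫ t, f t ∂(scalarSpectralMeasure hB x) = (⟪x, cfc f B x⟫_ℂ).re :=
  (exists_scalarSpectralMeasure hB x).choose_spec.2.2 f hf

theorem integrable_scalarSpectralMeasure {f : ℝ → ℝ} (hf : Continuous f) (x : H) :
    Integrable f (scalarSpectralMeasure hB x) := by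
  have h1 : ∀ᵐ t ∂(scalarSpectralMeasure hB x), t ∈ spectrum ℝ B :=
    (exists_scalarSpectralMeasure hB x).choose_spec.2.1
  have h2 : IntegrableOn f (spectrum ℝ B) (scalarSpectralMeasure hB x) :=
    hf.continuousOn.integrableOn_compact (spectrum.isCompact B)
  rwa [IntegrableOn, Measure.restrict_eq_self_of_ae_mem h1] at h2

theorem inner_cfc_left (f : ℝ → ℝ) (x y : H) : ⟪cfc f B x, y⟫_ℂ = ⟪x, cfc f B y⟫_ℂ := by
  have h : IsSelfAdjoint (cfc f B) := IsSelfAdjoint.cfc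
  conv_lhs => rw [← h.star_eq]
  exact star_inner_left _ _ _

/-- The map `f ↦ f(B) x` is isometric for the `L²` norm of the scalar measure; this reduces
convergence of vectors to convergence of integrals. -/
theorem norm_cfc_apply_sq {f : ℝ → ℝ} (hf : Continuous f) (x : H) :
    ‖cfc f B x‖ ^ 2 = ∫ t, f t ^ 2 ∂(scalarSpectralMeasure hB x) := by
  have h1 : cfc (fun t => f t * f t) B = cfc f B * cfc f B :=
    cfc_mul f f B hf.continuousOn hf.continuousOn
  simp only [pow_two (f _)]
  rw [integral_scalarSpectralMeasure hB (f := fun t => f t * f t) (hf.mul hf), h1, mul_apply_eq_comp,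
    ← inner_cfc_left]
  exact (inner_self_eq_norm_sq (𝕜 := ℂ) (cfc f B x)).symm

theorem norm_cfc_sub_sq {f g : ℝ → ℝ} (hf : Continuous f) (hg : Continuous g) (x : H) :
    ‖cfc f B x - cfc g B x‖ ^ 2 = ∫ t, (f t - g t) ^ 2 ∂(scalarSpectralMeasure hB x) := by
  rw [← norm_cfc_apply_sq hB (f := fun t => f t - g t) (hf.sub hg), cfc_sub f g B hf.continuousOn hg.continuousOn,
    sub_apply]

theorem scalarSpectralMeasure_real_univ (x : H) :
    (scalarSpectralMeasure hB x).real Set.univ = ‖x‖ ^ 2 := by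
  have h := norm_cfc_apply_sq hB (continuous_const (y := (1 : ℝ))) x
  rw [cfc_const_one ℝ B] at h
  simpa using h.symm

include hB in
theorem norm_cfc_apply_le {f : ℝ → ℝ} (hf : Continuous f) (h1 : ∀ t, |f t| ≤ 1) (x : H) :
    ‖cfc f B x‖ ≤ ‖x‖ := by
  refine abs_le_of_sq_le_sq' ?_ (norm_nonneg _) |>.2
  rw [norm_cfc_apply_sq hB hf, ← scalarSpectralMeasure_real_univ hB x]
  calc ∫ t, f t ^ 2 ∂(scalarSpectralMeasure hB x) ≤ ∫ _, (1 : ℝ) ∂(scalarSpectralMeasure hB x) := by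
        refine integral_mono (integrable_scalarSpectralMeasure hB (hf.pow 2) x)
          (integrable_const 1) fun t => ?_
        rw [← sq_abs]
        exact pow_le_one₀ (abs_nonneg _) (h1 t)
    _ = _ := by simp

theorem tendsto_sub_cfc {f g : ℕ → ℝ → ℝ} (hf : ∀ n, Continuous (f n))
    (hg : ∀ n, Continuous (g n)) {x : H} (h : Tendsto
      (fun n => ∫ t, (f n t - g n t) ^ 2 ∂(scalarSpectralMeasure hB x)) atTop (𝓝 0)) :
    Tendsto (fun n => cfc (f n) B x - cfc (g n) B x) atTop (𝓝 0) := by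
  simp only [← norm_cfc_sub_sq hB (hf _) (hg _)] at h
  rw [tendsto_zero_iff_norm_tendsto_zero]
  simpa [Function.comp_def] using (Real.continuous_sqrt.tendsto 0).comp h

theorem exists_tendsto_cfc {f : ℕ → ℝ → ℝ} (hf : ∀ n, Continuous (f n)) {d : ℕ → ℝ}
    (hd : Tendsto d atTop (𝓝 0)) {x : H}
    (h : ∀ m n, ∫ t, (f m t - f n t) ^ 2 ∂(scalarSpectralMeasure hB x) ≤ d m + d n) :
    ∃ z, Tendsto (fun n => cfc (f n) B x) atTop (𝓝 z) := by
  refine cauchySeq_tendsto_of_complete (Metric.cauchySeq_iff.mpr fun ε hε => ?_)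
  obtain ⟨N, hN⟩ := (Metric.tendsto_atTop.mp hd) (ε ^ 2 / 2) (by positivity)
  refine ⟨N, fun m hm n hn => ?_⟩
  rw [dist_eq_norm]
  refine abs_lt_of_sq_lt_sq' ?_ hε.le |>.2
  rw [norm_cfc_sub_sq hB (hf m) (hf n)]
  have h1 := hN m hm
  have h2 := hN n hn
  rw [Real.dist_eq, sub_zero] at h1 h2
  linarith [h m n, le_abs_self (d m), le_abs_self (d n)]

/-! ### Approximation of indicator functions -/

/-- Continuous functions with values in `[0, 1]` that converge in `L¹` to the indicator of `s`. -/
structure ApproximatesIndicator (ν : Measure ℝ) (s : Set ℝ) (f : ℕ → ℝ → ℝ) : Prop where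
  continuous : ∀ n, Continuous (f n)
  mem_Icc : ∀ n t, f n t ∈ Set.Icc (0 : ℝ) 1
  tendsto : Tendsto (fun n => ∫ t, |f n t - s.indicator 1 t| ∂ν) atTop (𝓝 0)

namespace ApproximatesIndicator

theorem abs_sub_le {ν : Measure ℝ} {s : Set ℝ} {f : ℕ → ℝ → ℝ} (h : ApproximatesIndicator ν s f)
    (n : ℕ) (t : ℝ) : |f n t - s.indicator 1 t| ≤ 1 := by
  have h1 := h.mem_Icc n t
  rw [abs_le]
  by_cases ht : t ∈ s
  · rw [Set.indicator_of_mem ht, Pi.one_apply]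
    constructor <;> linarith [h1.1, h1.2]
  · rw [Set.indicator_of_notMem ht]
    constructor <;> linarith [h1.1, h1.2]

theorem integrable {ν : Measure ℝ} [IsFiniteMeasure ν] {s : Set ℝ} (hs : MeasurableSet s)
    {f : ℕ → ℝ → ℝ} (h : ApproximatesIndicator ν s f) (n : ℕ) :
    Integrable (fun t => |f n t - s.indicator 1 t|) ν := by
  refine Integrable.of_bound (C := 1) ?_ (Eventually.of_forall fun t => ?_)
  · exact (((h.continuous n).measurable.sub
      ((measurable_indicator_const_iff 1).mpr hs)).abs).aestronglyMeasurable
  · rw [Real.norm_eq_abs, abs_abs]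
    exact h.abs_sub_le n t

theorem mono {ν ν' : Measure ℝ} [IsFiniteMeasure ν'] (hν : ν ≤ ν') {s : Set ℝ}
    (hs : MeasurableSet s) {f : ℕ → ℝ → ℝ} (h : ApproximatesIndicator ν' s f) :
    ApproximatesIndicator ν s f :=
  ⟨h.continuous, h.mem_Icc, squeeze_zero (fun _ => integral_nonneg fun _ => abs_nonneg _)
    (fun n => integral_mono_measure hν (Eventually.of_forall fun _ => abs_nonneg _)
      (h.integrable hs n)) h.tendsto⟩

theorem inter {ν : Measure ℝ} [IsFiniteMeasure ν] {s s' : Set ℝ} (hs : MeasurableSet s)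
    (hs' : MeasurableSet s') {f f' : ℕ → ℝ → ℝ} (h : ApproximatesIndicator ν s f)
    (h' : ApproximatesIndicator ν s' f') :
    ApproximatesIndicator ν (s ∩ s') (fun n t => f n t * f' n t) := by
  refine ⟨fun n => (h.continuous n).mul (h'.continuous n), fun n t => ?_, ?_⟩
  · have h1 := h.mem_Icc n t
    have h2 := h'.mem_Icc n t
    exact ⟨mul_nonneg h1.1 h2.1, mul_le_one₀ h1.2 h2.1 h2.2⟩
  · have hlim := h.tendsto.add h'.tendsto
    rw [add_zero] at hlim
    refine squeeze_zero (fun _ => integral_nonneg fun _ => abs_nonneg _) (fun n => ?_) hlim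
    rw [← integral_add (h.integrable hs n) (h'.integrable hs' n)]
    refine integral_mono_of_nonneg (Eventually.of_forall fun _ => abs_nonneg _)
      ((h.integrable hs n).add (h'.integrable hs' n)) (Eventually.of_forall fun t => ?_)
    have h1 := h.mem_Icc n t
    have e : f n t * f' n t - (s ∩ s').indicator 1 t =
        f n t * (f' n t - s'.indicator 1 t) + (f n t - s.indicator 1 t) * s'.indicator 1 t := by
      rw [Set.inter_indicator_one, Pi.mul_apply]
      ring
    have h3 : |s'.indicator (1 : ℝ → ℝ) t| ≤ 1 := by
      by_cases ht : t ∈ s' <;> simp [ht]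
    have h4 : |f n t| ≤ 1 := by
      rw [abs_of_nonneg h1.1]
      exact h1.2
    simp only
    rw [e]
    refine (abs_add_le _ _).trans ?_
    rw [abs_mul, abs_mul, add_comm]
    exact add_le_add (mul_le_of_le_one_right (abs_nonneg _) h3)
      (mul_le_of_le_one_left (abs_nonneg _) h4)

/-- For differences bounded by `1` the square is at most the absolute value, so `L¹` approximation
already controls `L²` distances. -/
theorem integral_sub_sq_le {ν : Measure ℝ} [IsFiniteMeasure ν] {s : Set ℝ} (hs : MeasurableSet s)
    {f f' : ℕ → ℝ → ℝ} (h : ApproximatesIndicator ν s f) (h' : ApproximatesIndicator ν s f')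
    (m n : ℕ) : ∫ t, (f m t - f' n t) ^ 2 ∂ν ≤
      ∫ t, |f m t - s.indicator 1 t| ∂ν + ∫ t, |f' n t - s.indicator 1 t| ∂ν := by
  rw [← integral_add (h.integrable hs m) (h'.integrable hs n)]
  refine integral_mono_of_nonneg (Eventually.of_forall fun t => sq_nonneg _)
    ((h.integrable hs m).add (h'.integrable hs n)) (Eventually.of_forall fun t => ?_)
  have h1 := h.mem_Icc m t
  have h2 := h'.mem_Icc n t
  have h3 : |f m t - f' n t| ≤ 1 := by
    rw [abs_le]
    constructor <;> linarith [h1.1, h1.2, h2.1, h2.2]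
  have h4 : |f m t - f' n t| ≤ |f m t - s.indicator 1 t| + |f' n t - s.indicator 1 t| := by
    rw [abs_sub_comm (f' n t)]
    exact _root_.abs_sub_le _ _ _
  simp only
  rw [← sq_abs]
  nlinarith [abs_nonneg (f m t - f' n t)]

end ApproximatesIndicator

/-- Urysohn functions between a closed `F ⊆ s` and an open `U ⊇ s`; the error lives on `U \ F`,
which has small measure by regularity. -/
theorem exists_approximatesIndicator (ν : Measure ℝ) [IsFiniteMeasure ν] {s : Set ℝ}
    (hs : MeasurableSet s) : ∃ f, ApproximatesIndicator ν s f := by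
  have key : ∀ n : ℕ, ∃ f : C(ℝ, ℝ), (∀ t, f t ∈ Set.Icc (0 : ℝ) 1) ∧
      ∫ t, |f t - s.indicator 1 t| ∂ν ≤ 2 * (1 / ((n : ℝ) + 1)) := by
    intro n
    have hpos : 0 < 1 / ((n : ℝ) + 1) := by positivity
    have hne : ENNReal.ofReal (1 / ((n : ℝ) + 1)) ≠ 0 := (ENNReal.ofReal_pos.mpr hpos).ne'
    obtain ⟨F, hFs, hF, hF'⟩ := hs.exists_isClosed_sdiff_lt (measure_ne_top ν s) hne
    obtain ⟨U, hsU, hU, -, hU'⟩ := hs.exists_isOpen_sdiff_lt (measure_ne_top ν s) hne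
    obtain ⟨f, hf0, hf1, hf⟩ := exists_continuous_zero_one_of_isClosed hU.isClosed_compl hF
      (Set.disjoint_compl_left_iff_subset.mpr (hFs.trans hsU))
    refine ⟨f, hf, ?_⟩
    have hm : MeasurableSet (s \ F ∪ U \ s) :=
      (hs.diff hF.measurableSet).union (hU.measurableSet.diff hs)
    calc ∫ t, |f t - s.indicator 1 t| ∂ν
        ≤ ∫ t, (s \ F ∪ U \ s).indicator (1 : ℝ → ℝ) t ∂ν := by
          refine integral_mono_of_nonneg (Eventually.of_forall fun _ => abs_nonneg _)
            ((integrable_const 1).indicator hm) (Eventually.of_forall fun t => ?_)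
          have h1 := hf t
          have h2 : ∀ t, 0 ≤ (s \ F ∪ U \ s).indicator (1 : ℝ → ℝ) t :=
            Set.indicator_nonneg fun _ _ => zero_le_one
          simp only
          by_cases hts : t ∈ s
          · by_cases htF : t ∈ F
            · rw [hf1 htF, Set.indicator_of_mem hts]
              simpa using h2 t
            · rw [Set.indicator_of_mem hts, Set.indicator_of_mem (show t ∈ s \ F ∪ U \ s from Or.inl ⟨hts, htF⟩),
                abs_le, Pi.one_apply]
              constructor <;> linarith [h1.1, h1.2]
          · by_cases htU : t ∈ U
            · rw [Set.indicator_of_notMem hts, Set.indicator_of_mem (show t ∈ s \ F ∪ U \ s from Or.inr ⟨htU, hts⟩), sub_zero,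
                abs_of_nonneg h1.1]
              exact h1.2
            · rw [hf0 htU, Set.indicator_of_notMem hts]
              simpa using h2 t
      _ = ν.real (s \ F ∪ U \ s) := by rw [integral_indicator_one hm]
      _ ≤ ν.real (s \ F) + ν.real (U \ s) := measureReal_union_le _ _
      _ ≤ 1 / ((n : ℝ) + 1) + 1 / ((n : ℝ) + 1) := by
          gcongr
          · exact ENNReal.toReal_le_of_le_ofReal hpos.le hF'.le
          · exact ENNReal.toReal_le_of_le_ofReal hpos.le hU'.le
      _ = _ := by ring
  choose f hf hlim using key
  refine ⟨fun n => f n, fun n => (f n).continuous, hf, ?_⟩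
  refine squeeze_zero (fun _ => integral_nonneg fun _ => abs_nonneg _) hlim ?_
  simpa using (tendsto_one_div_add_atTop_nhds_zero_nat (𝕜 := ℝ)).const_mul 2

end ScalarSpectralMeasure

/-! ### Spectral projections as strong limits of continuous functions of the operator. -/

section SpectralProjection

open Filter Topology MeasureTheory

variable {H : Type*} [NormedAddCommGroup H] [InnerProductSpace ℂ H] [CompleteSpace H]
  {B : H →L[ℂ] H} (hB : IsSelfAdjoint B)

theorem exists_tendsto_of_approximatesIndicator {s : Set ℝ} (hs : MeasurableSet s) (x : H) :
    ∃ z, ∀ f, ApproximatesIndicator (scalarSpectralMeasure hB x) s f →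
      Tendsto (fun n => cfc (f n) B x) atTop (𝓝 z) := by
  obtain ⟨g, hg⟩ := exists_approximatesIndicator (scalarSpectralMeasure hB x) hs
  obtain ⟨z, hz⟩ := exists_tendsto_cfc hB hg.continuous hg.tendsto
    (fun m n => hg.integral_sub_sq_le hs hg m n)
  refine ⟨z, fun f hf => ?_⟩
  have hlim := hf.tendsto.add hg.tendsto
  rw [add_zero] at hlim
  have h1 := tendsto_sub_cfc hB hf.continuous hg.continuous
    (squeeze_zero (fun _ => integral_nonneg fun _ => sq_nonneg _)
      (fun n => hf.integral_sub_sq_le hs hg n n) hlim)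
  simpa using h1.add hz

open scoped Classical in
/-- The value at `x` of the spectral projection of `B` attached to `s`. -/
noncomputable def spectralProjectionFun (s : Set ℝ) (x : H) : H :=
  if hs : MeasurableSet s then (exists_tendsto_of_approximatesIndicator hB hs x).choose else 0

theorem tendsto_spectralProjectionFun {s : Set ℝ} (hs : MeasurableSet s) {x : H} {f : ℕ → ℝ → ℝ}
    (hf : ApproximatesIndicator (scalarSpectralMeasure hB x) s f) :
    Tendsto (fun n => cfc (f n) B x) atTop (𝓝 (spectralProjectionFun hB s x)) := by
  rw [spectralProjectionFun, dif_pos hs]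
  exact (exists_tendsto_of_approximatesIndicator hB hs x).choose_spec f hf

/-- The limit at a vector does not depend on the approximating sequence, so one sequence adapted to
the sum of the three measures serves all three vectors. -/
theorem spectralProjectionFun_add {s : Set ℝ} (hs : MeasurableSet s) (x y : H) :
    spectralProjectionFun hB s (x + y) =
      spectralProjectionFun hB s x + spectralProjectionFun hB s y := by
  obtain ⟨f, hf⟩ := exists_approximatesIndicator (scalarSpectralMeasure hB x +
    scalarSpectralMeasure hB y + scalarSpectralMeasure hB (x + y)) hs
  have h1 := tendsto_spectralProjectionFun hB hs
    (hf.mono (Measure.le_add_right (Measure.le_add_right le_rfl)) hs)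
  have h2 := tendsto_spectralProjectionFun hB hs
    (hf.mono (Measure.le_add_right (Measure.le_add_left le_rfl)) hs)
  have h3 := tendsto_spectralProjectionFun hB hs (hf.mono (Measure.le_add_left le_rfl) hs)
  simp only [map_add] at h3
  exact tendsto_nhds_unique h3 (h1.add h2)

theorem spectralProjectionFun_smul {s : Set ℝ} (hs : MeasurableSet s) (c : ℂ) (x : H) :
    spectralProjectionFun hB s (c • x) = c • spectralProjectionFun hB s x := by
  obtain ⟨f, hf⟩ := exists_approximatesIndicator
    (scalarSpectralMeasure hB x + scalarSpectralMeasure hB (c • x)) hs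
  have h1 := tendsto_spectralProjectionFun hB hs (hf.mono (Measure.le_add_right le_rfl) hs)
  have h2 := tendsto_spectralProjectionFun hB hs (hf.mono (Measure.le_add_left le_rfl) hs)
  simp only [map_smul] at h2
  exact tendsto_nhds_unique h2 (h1.const_smul c)

include hB in
theorem norm_cfc_apply_le_of_approximatesIndicator {ν : Measure ℝ} {s : Set ℝ}
    {f : ℕ → ℝ → ℝ} (hf : ApproximatesIndicator ν s f) (n : ℕ) (x : H) : ‖cfc (f n) B x‖ ≤ ‖x‖ :=
  norm_cfc_apply_le hB (hf.continuous n)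
    (fun t => by rw [abs_of_nonneg (hf.mem_Icc n t).1]; exact (hf.mem_Icc n t).2) x

theorem norm_spectralProjectionFun_le {s : Set ℝ} (hs : MeasurableSet s) (x : H) :
    ‖spectralProjectionFun hB s x‖ ≤ ‖x‖ := by
  obtain ⟨f, hf⟩ := exists_approximatesIndicator (scalarSpectralMeasure hB x) hs
  exact le_of_tendsto (tendsto_spectralProjectionFun hB hs hf).norm
    (Eventually.of_forall fun n => norm_cfc_apply_le_of_approximatesIndicator hB hf n x)

/-- The spectral projection of the bounded self-adjoint operator `B` attached to a Borel set. -/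
noncomputable def spectralProjection (s : Set ℝ) (hs : MeasurableSet s) : H →L[ℂ] H :=
  LinearMap.mkContinuous
    { toFun := spectralProjectionFun hB s
      map_add' := spectralProjectionFun_add hB hs
      map_smul' := spectralProjectionFun_smul hB hs } 1
    (fun x => by rw [one_mul]; exact norm_spectralProjectionFun_le hB hs x)

theorem tendsto_spectralProjection {s : Set ℝ} (hs : MeasurableSet s) {x : H} {f : ℕ → ℝ → ℝ}
    (hf : ApproximatesIndicator (scalarSpectralMeasure hB x) s f) :
    Tendsto (fun n => cfc (f n) B x) atTop (𝓝 (spectralProjection hB s hs x)) :=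
  tendsto_spectralProjectionFun hB hs hf

theorem isSelfAdjoint_spectralProjection {s : Set ℝ} (hs : MeasurableSet s) :
    IsSelfAdjoint (spectralProjection hB s hs) := by
  rw [ContinuousLinearMap.isSelfAdjoint_iff_isSymmetric]
  intro x y
  obtain ⟨f, hf⟩ := exists_approximatesIndicator
    (scalarSpectralMeasure hB x + scalarSpectralMeasure hB y) hs
  have h1 := tendsto_spectralProjection hB hs (hf.mono (Measure.le_add_right le_rfl) hs)
  have h2 := tendsto_spectralProjection hB hs (hf.mono (Measure.le_add_left le_rfl) hs)
  refine tendsto_nhds_unique (h1.inner (𝕜 := ℂ) (tendsto_const_nhds (x := y))) ?_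
  simp only [inner_cfc_left]
  exact tendsto_const_nhds.inner h2

theorem spectralProjection_mul {s t : Set ℝ} (hs : MeasurableSet s) (ht : MeasurableSet t) :
    spectralProjection hB s hs * spectralProjection hB t ht =
      spectralProjection hB (s ∩ t) (hs.inter ht) := by
  ext x
  rw [mul_apply_eq_comp]
  set w := spectralProjection hB t ht x with hw
  obtain ⟨f, hf⟩ := exists_approximatesIndicator
    (scalarSpectralMeasure hB w + scalarSpectralMeasure hB x) hs
  obtain ⟨g, hg⟩ := exists_approximatesIndicator (scalarSpectralMeasure hB x) ht
  have h1 := tendsto_spectralProjection hB hs (hf.mono (Measure.le_add_right le_rfl) hs)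
  have hfx := hf.mono (Measure.le_add_left le_rfl) hs
  have h2 := tendsto_spectralProjection hB ht hg
  have h3 := tendsto_spectralProjection hB (hs.inter ht) (hfx.inter hs ht hg)
  -- Uniform contractivity of `f n (B)` lets the argument vary with `n`.
  have h4 : Tendsto (fun n => cfc (f n) B (w - cfc (g n) B x)) atTop (𝓝 0) := by
    refine squeeze_zero_norm (fun n => norm_cfc_apply_le_of_approximatesIndicator hB hf n _) ?_
    simpa [← hw] using (h2.const_sub w).norm
  have h5 := h1.sub h4
  rw [sub_zero] at h5
  refine tendsto_nhds_unique h5 (h3.congr fun n => ?_)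
  rw [cfc_mul (f n) (g n) B (hf.continuous n).continuousOn (hg.continuous n).continuousOn,
    mul_apply_eq_comp, map_sub, sub_sub_cancel]

theorem isStarProjection_spectralProjection {s : Set ℝ} (hs : MeasurableSet s) :
    IsStarProjection (spectralProjection hB s hs) :=
  ⟨by rw [IsIdempotentElem, spectralProjection_mul]; simp only [Set.inter_self],
    isSelfAdjoint_spectralProjection hB hs⟩

theorem norm_spectralProjection_sq {s : Set ℝ} (hs : MeasurableSet s) (x : H) :
    ‖spectralProjection hB s hs x‖ ^ 2 = (scalarSpectralMeasure hB x).real s := by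
  obtain ⟨f, hf⟩ := exists_approximatesIndicator (scalarSpectralMeasure hB x) hs
  have h1 := tendsto_spectralProjection hB hs hf
  have h2 : Tendsto (fun n => (⟪x, cfc (f n) B x⟫_ℂ).re) atTop
      (𝓝 (⟪x, spectralProjection hB s hs x⟫_ℂ).re) :=
    (Complex.continuous_re.tendsto _).comp (tendsto_const_nhds.inner h1)
  simp only [← integral_scalarSpectralMeasure hB (hf.continuous _)] at h2
  have h3 : Tendsto (fun n => ∫ t, f n t ∂(scalarSpectralMeasure hB x)) atTop
      (𝓝 ((scalarSpectralMeasure hB x).real s)) := by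
    rw [tendsto_iff_norm_sub_tendsto_zero]
    refine squeeze_zero (fun _ => norm_nonneg _) (fun n => ?_) hf.tendsto
    have hi : Integrable (s.indicator (1 : ℝ → ℝ)) (scalarSpectralMeasure hB x) :=
      (integrable_const 1).indicator hs
    rw [← integral_indicator_one hs, ← integral_sub
      (integrable_scalarSpectralMeasure hB (hf.continuous n) x) hi]
    exact norm_integral_le_integral_norm _
  rw [← tendsto_nhds_unique h2 h3]
  have h4 := congrArg (fun T : H →L[ℂ] H => T x)
    (isStarProjection_spectralProjection hB hs).isIdempotentElem.eq
  simp only [mul_apply_eq_comp] at h4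
  conv_rhs => rw [← h4, ← star_inner_left, (isSelfAdjoint_spectralProjection hB hs).star_eq]
  exact (inner_self_eq_norm_sq (𝕜 := ℂ) _).symm

end SpectralProjection

/-! ### Projection valued measures assembled from scalar measures. -/

section OfMeasures

open Filter Topology MeasureTheory

variable {H : Type*} [NormedAddCommGroup H] [InnerProductSpace ℂ H] [CompleteSpace H]

open scoped Classical in
/-- A multiplicative family of projections, whose quadratic forms are measures, is a projection
valued measure. -/
noncomputable def ProjectionValuedMeasure.ofMeasures
    (E : ∀ s : Set ℝ, MeasurableSet s → (H →L[ℂ] H))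
    (μ : H → Measure ℝ) [∀ x, IsFiniteMeasure (μ x)] (hE : ∀ s hs, IsStarProjection (E s hs))
    (hmul : ∀ s t hs ht, E s hs * E t ht = E (s ∩ t) (hs.inter ht))
    (huniv : E Set.univ .univ = 1) (hμ : ∀ s hs x, ‖E s hs x‖ ^ 2 = (μ x).real s) :
    ProjectionValuedMeasure H where
  proj s := if hs : MeasurableSet s then E s hs else 0
  isStarProjection' s hs := by rw [dif_pos hs]; exact hE s hs
  not_measurable' s hs := dif_neg hs
  empty' := by
    rw [dif_pos .empty]
    ext x
    have h := hμ ∅ .empty x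
    rw [measureReal_empty] at h
    simpa using h
  univ' := by rw [dif_pos .univ]; exact huniv
  inter' s t hs ht := by
    rw [dif_pos hs, dif_pos ht, dif_pos (hs.inter ht)]
    exact hmul s t hs ht
  iUnion' s hs hd x := by
    have hadj : ∀ s hs a b, ⟪E s hs a, b⟫_ℂ = ⟪a, E s hs b⟫_ℂ := fun s hs a b => by
      conv_lhs => rw [← (hE s hs).isSelfAdjoint.star_eq]
      exact star_inner_left _ _ _
    have hinner : ∀ s hs, ⟪x, E s hs x⟫_ℂ = (((μ x).real s : ℝ) : ℂ) := fun s hs => by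
      have h4 := congrArg (fun T : H →L[ℂ] H => T x) (hE s hs).isIdempotentElem.eq
      simp only [mul_apply_eq_comp] at h4
      rw [← hμ s hs x]
      conv_lhs => rw [← h4, ← hadj, inner_self_eq_norm_sq_to_K]
      norm_cast
    have hEE : ∀ s t hs ht, ⟪E s hs x, E t ht x⟫_ℂ = (((μ x).real (s ∩ t) : ℝ) : ℂ) :=
      fun s t hs ht => by
        rw [hadj, ← hinner _ (hs.inter ht), ← hmul, mul_apply_eq_comp]
    have hU := MeasurableSet.iUnion hs
    simp only [dif_pos (hs _), dif_pos hU]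
    have horth : ∀ N, ∀ k, N ≤ k →
        ⟪∑ n ∈ Finset.range N, E (s n) (hs n) x, E (s k) (hs k) x⟫_ℂ = 0 :=
      fun N k hk => by
        rw [sum_inner]
        refine Finset.sum_eq_zero fun n hn => ?_
        rw [hEE, hd n k ((Finset.mem_range.mp hn).trans_le hk).ne, measureReal_empty,
          Complex.ofReal_zero]
    -- Pythagoras for the orthogonal pieces turns countable additivity of `μ x` into strong
    -- convergence.
    have hnorm : ∀ N, ‖E _ hU x - ∑ n ∈ Finset.range N, E (s n) (hs n) x‖ ^ 2 =
        (μ x).real (⋃ n, s n) - ∑ n ∈ Finset.range N, (μ x).real (s n) := by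
      intro N
      induction N with
      | zero => simp [hμ]
      | succ N ih =>
        rw [Finset.sum_range_succ, Finset.sum_range_succ, ← sub_sub, norm_sub_sq (𝕜 := ℂ), ih,
          inner_sub_left, horth N N le_rfl, sub_zero, hEE,
          Set.inter_eq_self_of_subset_right (Set.subset_iUnion s N), hμ,
          show RCLike.re (((μ x).real (s N) : ℝ) : ℂ) = (μ x).real (s N) from Complex.ofReal_re _]
        ring
    have hsum : Tendsto (fun N => ∑ n ∈ Finset.range N, (μ x).real (s n)) atTop
        (𝓝 ((μ x).real (⋃ n, s n))) := by
      have h1 := measure_iUnion (μ := μ x)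
        (fun m n hmn => Set.disjoint_iff_inter_eq_empty.mpr (hd m n hmn)) hs
      have h2 : HasSum (fun n => (μ x).real (s n)) ((μ x).real (⋃ n, s n)) := by
        rw [Measure.real, h1, ENNReal.tsum_toReal_eq fun _ => measure_ne_top _ _]
        exact ENNReal.hasSum_toReal (h1 ▸ measure_ne_top _ _)
      exact h2.tendsto_sum_nat
    have hlim : Tendsto (fun N => ‖∑ n ∈ Finset.range N, E (s n) (hs n) x - E _ hU x‖ ^ 2) atTop
        (𝓝 0) := by
      simp only [norm_sub_rev _ (E _ hU x), hnorm]
      simpa using hsum.const_sub ((μ x).real (⋃ n, s n))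
    rw [tendsto_iff_norm_sub_tendsto_zero]
    simpa [Function.comp_def] using (Real.continuous_sqrt.tendsto 0).comp hlim

theorem ProjectionValuedMeasure.scalarMeasure_ofMeasures
    (E : ∀ s : Set ℝ, MeasurableSet s → (H →L[ℂ] H))
    (μ : H → Measure ℝ) [∀ x, IsFiniteMeasure (μ x)] (hE : ∀ s hs, IsStarProjection (E s hs))
    (hmul : ∀ s t hs ht, E s hs * E t ht = E (s ∩ t) (hs.inter ht))
    (huniv : E Set.univ .univ = 1) (hμ : ∀ s hs x, ‖E s hs x‖ ^ 2 = (μ x).real s) (x : H) :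
    (ProjectionValuedMeasure.ofMeasures E μ hE hmul huniv hμ).scalarMeasure x = μ x := by
  ext s hs
  rw [scalarMeasure_apply _ hs]
  simp only [ofMeasures, dif_pos hs, hμ]
  exact ENNReal.ofReal_toReal (measure_ne_top _ _)

/-- The projection valued measure of the function `g` of a bounded self-adjoint operator. -/
theorem exists_projectionValuedMeasure_map {B : H →L[ℂ] H} (hB : IsSelfAdjoint B) {g : ℝ → ℝ}
    (hg : Measurable g) : ∃ P : ProjectionValuedMeasure H,
      ∀ x, P.scalarMeasure x = (scalarSpectralMeasure hB x).map g := by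
  refine ⟨ProjectionValuedMeasure.ofMeasures
    (fun s hs => spectralProjection hB (g ⁻¹' s) (hg hs))
    (fun x => (scalarSpectralMeasure hB x).map g)
    (fun s hs => isStarProjection_spectralProjection hB (hg hs))
    (fun s t hs ht => spectralProjection_mul hB (hg hs) (hg ht)) ?_ (fun s hs x => ?_),
    fun x => ProjectionValuedMeasure.scalarMeasure_ofMeasures _ _ _ _ _ _ x⟩
  · ext x
    have h1 : ApproximatesIndicator (scalarSpectralMeasure hB x) (g ⁻¹' Set.univ) fun _ _ => 1 :=
      ⟨fun _ => continuous_const, fun _ _ => by simp, by simp⟩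
    have h2 := tendsto_spectralProjection hB (hg .univ) h1
    rw [cfc_const_one ℝ B] at h2
    exact tendsto_nhds_unique h2 tendsto_const_nhds
  · rw [norm_spectralProjection_sq, map_measureReal_apply hg hs]

end OfMeasures

/-! ### The spectral theorem for an unbounded positive operator, through its resolvent. -/

section SpectralTheorem

open Filter Topology MeasureTheory

variable {H : Type*} [NormedAddCommGroup H] [InnerProductSpace ℂ H] [CompleteSpace H]

section Resolvent

variable {B : H →L[ℂ] H} (hB : IsSelfAdjoint B)

theorem scalarSpectralMeasure_apply (w : H) : scalarSpectralMeasure hB (B w) =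
    (scalarSpectralMeasure hB w).withDensity fun t => ENNReal.ofReal (t ^ 2) := by
  have hm : Measurable fun t : ℝ => ENNReal.ofReal (t ^ 2) := by fun_prop
  have hfin : IsFiniteMeasure
      ((scalarSpectralMeasure hB w).withDensity fun t => ENNReal.ofReal (t ^ 2)) :=
    isFiniteMeasure_withDensity_ofReal
      (integrable_scalarSpectralMeasure hB (by fun_prop) w).hasFiniteIntegral
  refine ext_of_forall_integral_eq_of_IsFiniteMeasure fun f => ?_
  rw [integral_withDensity_eq_integral_toReal_smul hm
    (Eventually.of_forall fun t => ENNReal.ofReal_lt_top)]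
  have hf : Continuous f := f.continuous
  have h1 : ∀ t : ℝ, (ENNReal.ofReal (t ^ 2)).toReal • f t = t * (f t * t) := fun t => by
    rw [ENNReal.toReal_ofReal (sq_nonneg t), smul_eq_mul]
    ring
  simp only [h1]
  rw [integral_scalarSpectralMeasure hB hf,
    integral_scalarSpectralMeasure hB (f := fun t => t * (f t * t)) (by fun_prop),
    cfc_mul (fun t => t) (fun t => f t * t) B (by fun_prop) (by fun_prop),
    cfc_mul f (fun t => t) B (by fun_prop) (by fun_prop), cfc_id' ℝ B, mul_apply_eq_comp,
    mul_apply_eq_comp, ← star_inner_left B, hB.star_eq]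

/-- If `1 / t` is square integrable at `x`, then `x` is in the range of the injective bounded
self-adjoint operator `B`. -/
theorem mem_range_of_integrable (hinj : ∀ w, B w = 0 → w = 0) {x : H}
    (hx : Integrable (fun t : ℝ => (1 / t) ^ 2) (scalarSpectralMeasure hB x)) :
    ∃ w, B w = x := by
  set μ := scalarSpectralMeasure hB x with hμ
  set e : ℕ → ℝ := fun n => 1 / ((n : ℝ) + 1) with he_def
  have he : Tendsto e atTop (𝓝 0) := tendsto_one_div_add_atTop_nhds_zero_nat
  have hpos : ∀ n, 0 < e n := fun n => by positivity
  have hden : ∀ n t, 0 < t ^ 2 + e n := fun n t => by have := hpos n; positivity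
  -- The functions `h n` regularise `1 / t`, and `k n = 1 - t h n` is the defect, which tends to the
  -- indicator of `{0}`.
  set k : ℕ → ℝ → ℝ := fun n t => e n / (t ^ 2 + e n) with hk_def
  set h : ℕ → ℝ → ℝ := fun n t => t / (t ^ 2 + e n) with hh_def
  have hk : ∀ n, Continuous (k n) := fun n =>
    Continuous.div (by fun_prop) (by fun_prop) fun t => (hden n t).ne'
  have hh : ∀ n, Continuous (h n) := fun n =>
    Continuous.div (by fun_prop) (by fun_prop) fun t => (hden n t).ne'
  have hkI : ∀ n t, k n t ∈ Set.Icc (0 : ℝ) 1 := fun n t =>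
    ⟨div_nonneg (hpos n).le (hden n t).le,
      (div_le_one (hden n t)).mpr (by linarith [sq_nonneg t])⟩
  have hhk : ∀ n t, t * h n t = 1 - k n t := fun n t => by
    have := (hden n t).ne'
    simp only [hk_def, hh_def]
    field_simp
    ring
  have hden_lim : ∀ t, Tendsto (fun n => t ^ 2 + e n) atTop (𝓝 (t ^ 2)) := fun t => by
    simpa using he.const_add (t ^ 2)
  -- The limit is the spectral projection at `{0}` applied to `x`. It is annihilated by `B`, because
  -- `(t k n) ^ 2 ≤ e n`, hence is zero by injectivity.
  have hk0 : Tendsto (fun n => cfc (k n) B x) atTop (𝓝 0) := by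
    have happ : ApproximatesIndicator μ {0} k := by
      refine ⟨hk, hkI, ?_⟩
      have hlim : ∀ t, Tendsto (fun n => |k n t - ({0} : Set ℝ).indicator 1 t|) atTop (𝓝 0) := by
        intro t
        rcases eq_or_ne t 0 with rfl | ht
        · have h1 : ∀ n, k n 0 = 1 := fun n => by simp [hk_def, (hpos n).ne']
          simp [h1]
        · have h1 := he.div (hden_lim t) (pow_ne_zero 2 ht)
          simpa [hk_def, ht] using h1.abs
      have hbound : ∀ n, ∀ t, |k n t - ({0} : Set ℝ).indicator 1 t| ≤ 1 := by
        intro n t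
        have h1 := hkI n t
        rw [abs_le]
        rcases eq_or_ne t 0 with rfl | ht
        · simp only [Set.mem_singleton_iff, Set.indicator_of_mem, Pi.one_apply]
          constructor <;> linarith [h1.1, h1.2]
        · rw [Set.indicator_of_notMem (by simpa using ht)]
          constructor <;> linarith [h1.1, h1.2]
      have h1 := tendsto_integral_of_dominated_convergence (μ := μ) (fun _ => (1 : ℝ))
        (fun n => (((hk n).measurable.sub ((measurable_indicator_const_iff 1).mpr
          (measurableSet_singleton 0))).abs).aestronglyMeasurable) (integrable_const 1)
        (fun n => Eventually.of_forall fun t => by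
          rw [Real.norm_eq_abs, abs_abs]
          exact hbound n t)
        (Eventually.of_forall hlim)
      simpa using h1
    have hz := tendsto_spectralProjection hB (measurableSet_singleton 0) happ
    have hBz := (B.continuous.tendsto _).comp hz
    have hBk : ∀ n, B (cfc (k n) B x) = cfc (fun t => t * k n t) B x := fun n => by
      rw [cfc_mul (fun t => t) (k n) B (by fun_prop) (hk n).continuousOn, cfc_id' ℝ B,
        mul_apply_eq_comp]
    have hBk0 : Tendsto (fun n => cfc (fun t => t * k n t) B x - cfc (fun _ => (0 : ℝ)) B x) atTop
        (𝓝 0) := by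
      refine tendsto_sub_cfc hB (g := fun _ _ => 0) (fun n => by have := hk n; fun_prop)
        (fun n => by fun_prop) ?_
      have hlim : Tendsto (fun n => μ.real Set.univ * e n) atTop (𝓝 0) := by
        simpa using he.const_mul (μ.real Set.univ)
      refine squeeze_zero (fun _ => integral_nonneg fun _ => sq_nonneg _) (fun n => ?_) hlim
      calc ∫ t, (t * k n t - 0) ^ 2 ∂μ ≤ ∫ _, e n ∂μ := by
            refine integral_mono_of_nonneg (Eventually.of_forall fun _ => sq_nonneg _)
              (integrable_const _) (Eventually.of_forall fun t => ?_)
            simp only [hk_def, sub_zero]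
            rw [← mul_div_assoc, div_pow, div_le_iff₀ (pow_pos (hden n t) 2)]
            nlinarith [sq_nonneg (t ^ 2), hpos n, sq_nonneg t,
              mul_nonneg (hpos n).le (sq_nonneg (t ^ 2)), mul_nonneg (sq_nonneg (e n)) (sq_nonneg t),
              pow_pos (hpos n) 3]
        _ = μ.real Set.univ * e n := by rw [integral_const, smul_eq_mul]
    have h0 : B (spectralProjection hB {0} (measurableSet_singleton 0) x) = 0 := by
      refine tendsto_nhds_unique hBz ?_
      simpa [Function.comp_def, hBk] using hBk0
    rw [hinj _ h0] at hz
    exact hz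
  -- Since `h n - 1 / t = -(k n) / t`, dominated convergence applies with bound `(1 / t) ^ 2`. At `t
  -- = 0` both terms are zero, by the convention `1 / 0 = 0`.
  set d : ℕ → ℝ := fun n => ∫ t, (h n t - 1 / t) ^ 2 ∂μ with hd_def
  have hbound : ∀ n t, (h n t - 1 / t) ^ 2 ≤ (1 / t) ^ 2 := fun n t => by
    rcases eq_or_ne t 0 with rfl | ht
    · simp [hh_def]
    · have e1 : h n t - 1 / t = -(k n t) * (1 / t) := by
        have := hhk n t
        field_simp
        linarith
      rw [e1, mul_pow, neg_sq]
      exact mul_le_of_le_one_left (sq_nonneg _) (pow_le_one₀ (hkI n t).1 (hkI n t).2)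
  have hmeas : ∀ n, AEStronglyMeasurable (fun t : ℝ => (h n t - 1 / t) ^ 2) μ := fun n => by
    have := (hh n).measurable
    exact Measurable.aestronglyMeasurable (by fun_prop)
  have hint : ∀ n, Integrable (fun t : ℝ => (h n t - 1 / t) ^ 2) μ := fun n =>
    hx.mono' (hmeas n) (Eventually.of_forall fun t => by
      rw [Real.norm_eq_abs, abs_of_nonneg (sq_nonneg _)]
      exact hbound n t)
  have hd : Tendsto d atTop (𝓝 0) := by
    have hlim : ∀ t, Tendsto (fun n => (h n t - 1 / t) ^ 2) atTop (𝓝 0) := by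
      intro t
      rcases eq_or_ne t 0 with rfl | ht
      · simp [hh_def]
      · have h1 := (tendsto_const_nhds (x := t)).div (hden_lim t) (pow_ne_zero 2 ht)
        have h2 : t / t ^ 2 = 1 / t := by field_simp
        rw [h2] at h1
        simpa using (h1.sub_const (1 / t)).pow 2
    have h1 := tendsto_integral_of_dominated_convergence (μ := μ) (fun t => (1 / t) ^ 2) hmeas hx
      (fun n => Eventually.of_forall fun t => by
        rw [Real.norm_eq_abs, abs_of_nonneg (sq_nonneg _)]
        exact hbound n t)
      (Eventually.of_forall hlim)
    simpa [hd_def] using h1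
  have hd2 : Tendsto (fun n => 2 * d n) atTop (𝓝 0) := by simpa using hd.const_mul 2
  obtain ⟨w, hw⟩ := exists_tendsto_cfc hB hh hd2 (x := x) fun m n => by
    simp only [hd_def]
    rw [← integral_const_mul, ← integral_const_mul, ← integral_add ((hint m).const_mul 2)
      ((hint n).const_mul 2)]
    refine integral_mono_of_nonneg (Eventually.of_forall fun _ => sq_nonneg _)
      (((hint m).const_mul 2).add ((hint n).const_mul 2)) (Eventually.of_forall fun t => ?_)
    simp only
    nlinarith [sq_nonneg ((h m t - 1 / t) + (h n t - 1 / t))]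
  refine ⟨w, tendsto_nhds_unique ((B.continuous.tendsto _).comp hw) ?_⟩
  have hBh : ∀ n, B (cfc (h n) B x) = x - cfc (k n) B x := fun n => by
    have h1 : cfc (fun t => t * h n t) B = B * cfc (h n) B := by
      rw [cfc_mul (fun t => t) (h n) B (by fun_prop) (hh n).continuousOn, cfc_id' ℝ B]
    have h2 : cfc (fun t => t * h n t) B = 1 - cfc (k n) B := by
      simp only [hhk]
      rw [cfc_sub (fun _ => (1 : ℝ)) (k n) B (by fun_prop) (hk n).continuousOn, cfc_const_one ℝ B]
    rw [← mul_apply_eq_comp, ← h1, h2, sub_apply, one_apply_eq_self]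
  simp only [Function.comp_def, hBh]
  simpa using hk0.const_sub x

end Resolvent

/-- The spectral theorem for a positive symmetric operator `A` such that `1 + A` is surjective. -/
theorem exists_isSpectralMeasureOf (A : H →ₗ.[ℂ] H)
    (hpos : ∀ p ∈ A.graph, ∃ r : ℝ, 0 ≤ r ∧ ⟪p.1, p.2⟫_ℂ = (r : ℂ))
    (hsurj : ∀ w : H, ∃ p ∈ A.graph, p.1 + p.2 = w) :
    ∃ P : ProjectionValuedMeasure H, P.IsSpectralMeasureOf A := by
  have hnorm : ∀ p ∈ A.graph, ‖p.1‖ ≤ ‖p.1 + p.2‖ := by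
    intro p hp
    obtain ⟨r, hr, hpr⟩ := hpos p hp
    have h1 : (⟪p.1, p.1 + p.2⟫_ℂ).re ≤ ‖p.1‖ * ‖p.1 + p.2‖ :=
      (Complex.re_le_norm _).trans (norm_inner_le_norm _ _)
    have h2 : (⟪p.1, p.1⟫_ℂ).re = ‖p.1‖ ^ 2 := inner_self_eq_norm_sq (𝕜 := ℂ) p.1
    rw [inner_add_right, hpr, Complex.add_re, h2, Complex.ofReal_re] at h1
    rcases (norm_nonneg p.1).eq_or_lt with h | h
    · rw [← h]
      exact norm_nonneg _
    · exact le_of_mul_le_mul_left (by nlinarith) h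
  choose f hf hfw using hsurj
  have huniq : ∀ p ∈ A.graph, ∀ w, p.1 + p.2 = w → (f w).1 = p.1 := by
    intro p hp w hpw
    have h1 := hnorm _ (sub_mem (hf w) hp)
    have h2 : (f w - p).1 + (f w - p).2 = 0 := by
      rw [Prod.fst_sub, Prod.snd_sub, sub_add_sub_comm, hfw, hpw, sub_self]
    rw [h2, norm_zero, norm_le_zero_iff, Prod.fst_sub, sub_eq_zero] at h1
    exact h1
  -- `B = (1 + A)⁻¹`, a contraction because `A` is positive.
  let B : H →L[ℂ] H := LinearMap.mkContinuous
    { toFun := fun w => (f w).1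
      map_add' := fun v w => huniq _ (add_mem (hf v) (hf w)) _ (by
        rw [Prod.fst_add, Prod.snd_add, add_add_add_comm, hfw, hfw])
      map_smul' := fun c w => huniq _ (A.graph.smul_mem c (hf w)) _ (by
        rw [Prod.smul_fst, Prod.smul_snd, ← smul_add, hfw]) } 1
    (fun w => by
      have := hnorm _ (hf w)
      rw [hfw] at this
      simpa using this)
  have hBf : ∀ w, B w = (f w).1 := fun _ => rfl
  have hgraph : ∀ w, (B w, w - B w) ∈ A.graph := fun w => by
    have h1 : f w = (B w, w - B w) := Prod.ext rfl (by rw [hBf, eq_sub_iff_add_eq', hfw])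
    rw [← h1]
    exact hf w
  have hBp : ∀ p ∈ A.graph, B (p.1 + p.2) = p.1 := fun p hp => huniq p hp _ rfl
  have him : ∀ p ∈ A.graph, (⟪p.1, p.2⟫_ℂ).im = 0 := fun p hp => by
    obtain ⟨r, -, hr⟩ := hpos p hp
    rw [hr, Complex.ofReal_im]
  have hB : IsSelfAdjoint B := by
    rw [ContinuousLinearMap.isSelfAdjoint_iff_isSymmetric]
    intro v w
    have h := Submodule.inner_fst_snd_eq him (hgraph v) (hgraph w)
    simp only [inner_sub_left, inner_sub_right] at h
    simp only [ContinuousLinearMap.coe_coe]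
    linear_combination h
  have hinj : ∀ w, B w = 0 → w = 0 := fun w hw => by
    have h1 := hgraph w
    rw [hw, sub_zero] at h1
    exact A.mem_graph_snd_inj h1 A.graph.zero_mem rfl
  -- `A = g(B)` with `g t = 1 / t - 1`. The value `g 0 = -1` is harmless: vectors in the range of
  -- the injective `B` have the density `t ^ 2`, which vanishes at `0`.
  have hg : Measurable fun t : ℝ => 1 / t - 1 := by fun_prop
  obtain ⟨P, hP⟩ := exists_projectionValuedMeasure_map hB hg
  have hd : ∀ x, x ∈ A.domain ↔ ∃ w, B w = x := fun x => by
    rw [LinearPMap.mem_domain_iff]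
    exact ⟨fun ⟨y, hy⟩ => ⟨x + y, hBp _ hy⟩, fun ⟨w, hw⟩ => ⟨w - B w, hw ▸ hgraph w⟩⟩
  refine ⟨P, fun x => ?_, fun ⟨x, hx⟩ => ?_⟩
  · rw [hd, hP, lintegral_map (by fun_prop) hg]
    constructor
    · rintro ⟨w, rfl⟩
      rw [scalarSpectralMeasure_apply, lintegral_withDensity_eq_lintegral_mul _ (by fun_prop)
        (by fun_prop)]
      refine lt_of_le_of_lt (lintegral_mono fun t => ?_)
        (integrable_scalarSpectralMeasure hB (f := fun t => (1 - t) ^ 2) (by fun_prop)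
          w).lintegral_lt_top
      rw [Pi.mul_apply, ← ENNReal.ofReal_mul (sq_nonneg t)]
      refine ENNReal.ofReal_le_ofReal ?_
      rcases eq_or_ne t 0 with rfl | ht
      · simp
      · refine le_of_eq ?_
        field_simp
    · intro h
      refine mem_range_of_integrable hB hinj ?_
      have h1 : Integrable (fun t : ℝ => (1 / t - 1) ^ 2) (scalarSpectralMeasure hB x) :=
        ⟨by fun_prop, by
          rw [hasFiniteIntegral_iff_ofReal (Eventually.of_forall fun t => sq_nonneg _)]
          exact h⟩
      refine ((h1.const_mul 2).add (integrable_const 2)).mono' (by fun_prop)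
        (Eventually.of_forall fun t => ?_)
      rw [Real.norm_eq_abs, abs_of_nonneg (sq_nonneg _)]
      simp only [Pi.add_apply]
      -- With `v = 1 / t`, the difference `2 (v - 1) ^ 2 + 2 - v ^ 2` equals `(v - 2) ^ 2`.
      nlinarith [sq_nonneg (1 / t - 2)]
  · obtain ⟨w, rfl⟩ := (hd x).mp hx
    have h1 : A ⟨B w, hx⟩ = w - B w := A.mem_graph_snd_inj (A.mem_graph ⟨B w, hx⟩) (hgraph w) rfl
    have h2 : ⟪B w, w - B w⟫_ℂ = ((⟪B w, w - B w⟫_ℂ).re : ℂ) :=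
      Complex.ext rfl (by rw [him _ (hgraph w), Complex.ofReal_im])
    simp only [h1]
    rw [h2, hP, integral_map hg.aemeasurable (by fun_prop), scalarSpectralMeasure_apply,
      integral_withDensity_eq_integral_toReal_smul (by fun_prop)
        (Eventually.of_forall fun t => ENNReal.ofReal_lt_top)]
    congr 1
    have h3 : ∀ t : ℝ, (ENNReal.ofReal (t ^ 2)).toReal • (1 / t - 1) = t - t * t := fun t => by
      rw [ENNReal.toReal_ofReal (sq_nonneg t), smul_eq_mul]
      rcases eq_or_ne t 0 with rfl | ht
      · simp
      · field_simp
    simp only [h3]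
    rw [integral_scalarSpectralMeasure hB (f := fun t => t - t * t) (by fun_prop),
      cfc_sub (fun t => t) (fun t => t * t) B (by fun_prop) (by fun_prop),
      cfc_mul (fun t => t) (fun t => t) B (by fun_prop) (by fun_prop), cfc_id' ℝ B]
    conv_lhs => rw [← hB.star_eq, star_inner_left, hB.star_eq]
    rw [map_sub, sub_apply, mul_apply_eq_comp]

end SpectralTheorem

/-! ### Existence and invariance of the relative entropy. -/

section RelativeEntropy

variable {H : Type*} [NormedAddCommGroup H] [InnerProductSpace ℂ H] [CompleteSpace H]
  {M : VonNeumannAlgebra H} {Ψ Φ : H}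

theorem exists_isSpectralMeasureOf_relativeModularOperator (h : IsCyclicVector M Ψ)
    (h' : IsCyclicVector M.commutant Ψ) : ∃ P : ProjectionValuedMeasure H,
      P.IsSpectralMeasureOf (relativeModularOperator M Ψ Φ) := by
  refine exists_isSpectralMeasureOf _ (fun p hp => ?_) fun w => ?_
  · rw [graph_relativeModularOperator h h'] at hp
    obtain ⟨y, hy⟩ := exists_inner_eq_of_mem_relativeModularGraph hp
    exact ⟨_, by positivity, hy⟩
  · rw [graph_relativeModularOperator h h']
    exact exists_mem_relativeModularGraph_add_eq M Ψ Φ w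

/-- If an isometry `u` implements the elements of `M` and of its commutant by elements of `N` and of
its commutant, then it preserves relative entropies. -/
theorem exists_isRelativeEntropy_map {K : Type*} [NormedAddCommGroup K] [InnerProductSpace ℂ K]
    [CompleteSpace K] {N : VonNeumannAlgebra K} (u : H →ₗᵢ[ℂ] K)
    (hu : ∀ O ∈ M, ∃ T ∈ N, ∀ x, u (O x) = T (u x) ∧ u (star O x) = star T (u x))
    (hu' : ∀ O ∈ M.commutant, ∃ T ∈ N.commutant,
      ∀ x, u (O x) = T (u x) ∧ u (star O x) = star T (u x))
    (hM : IsCyclicVector M Ψ) (hM' : IsSeparatingVector M Ψ)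
    (hN : IsCyclicVector N (u Ψ)) (hN' : IsSeparatingVector N (u Ψ)) :
    ∃ s : EReal, IsRelativeEntropy M Ψ Φ s ∧ IsRelativeEntropy N (u Ψ) (u Φ) s := by
  have hMc := hM'.isCyclicVector_commutant
  have hNc := hN'.isCyclicVector_commutant
  obtain ⟨P, hP⟩ := exists_isSpectralMeasureOf_relativeModularOperator (Φ := Φ) hM hMc
  obtain ⟨Q, hQ⟩ := exists_isSpectralMeasureOf_relativeModularOperator (Φ := u Φ) hN hNc
  have hmap : ∀ p ∈ (relativeModularOperator M Ψ Φ).graph,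
      (u p.1, u p.2) ∈ (relativeModularOperator N (u Ψ) (u Φ)).graph := by
    rw [graph_relativeModularOperator hM hMc, graph_relativeModularOperator hN hNc]
    exact fun p hp => map_mem_relativeModularGraph u hM hMc
      (fun _ => map_mem_relativeTomitaGraph u hu) (fun _ => map_mem_relativeTomitaGraph u hu') hp
  have hPQ := hP.scalarMeasure_map hQ u hmap Ψ
  refine ⟨-P.logIntegral Ψ, ⟨hM, hM', P, hP, fun P' hP' => hP.eq_of_isSpectralMeasureOf hP', rfl⟩,
    ⟨hN, hN', Q, hQ, fun Q' hQ' => hQ.eq_of_isSpectralMeasureOf hQ', ?_⟩⟩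
  rw [ProjectionValuedMeasure.logIntegral, ProjectionValuedMeasure.logIntegral, hPQ]

end RelativeEntropy

theorem theorem2 {Hcode Hphys : Type*}
    [NormedAddCommGroup Hcode] [InnerProductSpace ℂ Hcode] [CompleteSpace Hcode]
    [NormedAddCommGroup Hphys] [InnerProductSpace ℂ Hphys] [CompleteSpace Hphys]
    (u : Hcode →ₗᵢ[ℂ] Hphys) (Mcode : VonNeumannAlgebra Hcode) (Mphys : VonNeumannAlgebra Hphys)
    (hΩ : ∃ Ω : Hcode, IsCyclicVector Mphys (u Ω) ∧ IsSeparatingVector Mphys (u Ω))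
    (hrec : ∀ O ∈ Mcode, ∀ O' ∈ Mcode.commutant,
      ∃ T ∈ Mphys, ∃ T' ∈ Mphys.commutant, ∀ Θ : Hcode,
        u (O Θ) = T (u Θ) ∧ u (O' Θ) = T' (u Θ) ∧
        u ((star O) Θ) = (star T) (u Θ) ∧ u ((star O') Θ) = (star T') (u Θ))
    (Ψ Φ : Hcode) (hcyc : IsCyclicVector Mcode Ψ) (hsep : IsSeparatingVector Mcode Ψ) :
    (IsCyclicVector Mphys (u Ψ) ∧ IsSeparatingVector Mphys (u Ψ) ∧
      IsCyclicVector Mphys.commutant (u Ψ) ∧ IsSeparatingVector Mphys.commutant (u Ψ)) ∧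
    (∃ s : EReal, IsRelativeEntropy Mcode Ψ Φ s ∧ IsRelativeEntropy Mphys (u Ψ) (u Φ) s) ∧
    (∃ s' : EReal, IsRelativeEntropy Mcode.commutant Ψ Φ s' ∧
      IsRelativeEntropy Mphys.commutant (u Ψ) (u Φ) s') := by
  obtain ⟨Ω, hΩc, hΩs⟩ := hΩ
  have hu : ∀ O ∈ Mcode, ∃ T ∈ Mphys, ∀ x, u (O x) = T (u x) ∧ u (star O x) = star T (u x) :=
    fun O hO => by
      obtain ⟨T, hT, _, _, h⟩ := hrec O hO 0 (zero_mem _)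
      exact ⟨T, hT, fun x => ⟨(h x).1, (h x).2.2.1⟩⟩
  have hu' : ∀ O ∈ Mcode.commutant, ∃ T ∈ Mphys.commutant,
      ∀ x, u (O x) = T (u x) ∧ u (star O x) = star T (u x) :=
    fun O hO => by
      obtain ⟨_, _, T, hT, h⟩ := hrec 0 (zero_mem _) O hO
      exact ⟨T, hT, fun x => ⟨(h x).2.1, (h x).2.2.2⟩⟩
  have hu'' : ∀ O ∈ Mcode.commutant.commutant, ∃ T ∈ Mphys.commutant.commutant,
      ∀ x, u (O x) = T (u x) ∧ u (star O x) = star T (u x) := by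
    simpa only [VonNeumannAlgebra.commutant_commutant] using hu
  have hcyc' := hsep.isCyclicVector_commutant
  have hsep' := hcyc.isSeparatingVector_commutant
  have hS : IsSeparatingVector Mphys (u Ψ) := isSeparatingVector_map u
    (fun O hO => (hu' O hO).imp fun _ h => ⟨h.1, fun x => (h.2 x).1⟩) hΩs hcyc'
  -- The same argument with algebra and commutant exchanged; here it is cyclicity of `u Ω` that
  -- makes it separating for the commutant.
  have hS' : IsSeparatingVector Mphys.commutant (u Ψ) := isSeparatingVector_map u
    (fun O hO => (hu'' O hO).imp fun _ h => ⟨h.1, fun x => (h.2 x).1⟩)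
    hΩc.isSeparatingVector_commutant (by rwa [VonNeumannAlgebra.commutant_commutant])
  have hC : IsCyclicVector Mphys (u Ψ) := hS'.isCyclicVector
  have hC' := hS.isCyclicVector_commutant
  exact ⟨⟨hC, hS, hC', hS'⟩, exists_isRelativeEntropy_map u hu hu' hcyc hsep hC hS,
    exists_isRelativeEntropy_map u hu' hu'' hcyc' hsep' hC' hS'⟩
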